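/- **Theorem 4.4.** Scalars are real or complex. Let $(h_j)_{j\ge 1}$ be a normalized Schauder basis of a reflexive Banach space $E$, and let $J(h_j)$ be the space of scalar sequences $a=(a_j)$ with $\lim_j a_j=0$ and $$\|a\|=\sup\Big\{\Big\|\sum_{j=1}^n (a_{p_j}-a_{q_j})h_{p_j}\Big\|_E : n\in\mathbb N,\ 1\le p_1<q_1<\dots<p_n<q_n\Big\}<\infty .$$ Then $J(h_j)$ is a Banach space which is quasi-reflexive of order one, i.e. $\dim J(h_j)^{**}/J(h_j)=1$, and it has the weakly compact approximation property (W.A.P.): there is $C<\infty$ such that for every weakly compact $D\subset J(h_j)$ and every $\varepsilon>0$ there is a weakly compact operator $V$ on $J(h_j)$ with $\sup_{x\in D}\|x-Vx\|<\varepsilon$ and $\|V\|\le C$. Moreover, there is $C<\infty$ such that, for all $D$ and $\varepsilon$, such a $V$ can be chosen of the following form. There are integers $1=t_1<t_2<\cdots$, giving the partition of $\mathbb N$ into the intervals $I_j=[t_j,t_{j+1})$, and for each $j$ a partition of $I_j$ into successive intervals $[n^{(j)}_r,n^{(j)}_{r+1})$, $1\le r\le k_j$, and weights $\alpha^{(j)}_r\ge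 0$ with $\sum_r\alpha^{(j)}_r=1$, such that, with $$V_j(x)=\sum_{r=1}^{k_j}\frac{\alpha^{(j)}_r}{n^{(j)}_{r+1}-n^{(j)}_r}\sum_{s=n^{(j)}_r}^{n^{(j)}_{r+1}-1}x(s),$$ $$ s_0=e_1,\quad s_1=\sum_{s=2}^{t_2-1}e_s,\quad s_j=\sum_{s\in I_j}e_s\ (j\ge 2),$$ where $(e_s)$ are the unit vectors of $J(h_j)$, one has $$Vx=x-\sum_{j=1}^\infty V_j(x)\,s_{j-1}\qquad (x\in J(h_j)),$$ the series converging in norm. If in addition $(h_j)$ is $1$-unconditional (multiplying coefficients by scalars of modulus one does not change norms) and satisfies $\|\sum_i a_ih_{m(i)}\|\le 2\|\sum_i a_ih_{n(i)}\|$ for all finite scalar sequences $(a_i)$ and all $1\le m(1)\le n(1)<m(2)\le n(2)<\cdots$, then the last assertion holds with $C=5$. -/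

import Mathlib

open Filter Topology

noncomputable section

/-! ### General Banach space notions -/

/-- A normed space is reflexive if the canonical embedding into its bidual is onto. -/
def IsReflexiveSpace (𝕜 X : Type*) [RCLike 𝕜] [NormedAddCommGroup X] [NormedSpace 𝕜 X] : Prop :=
  Function.Surjective (NormedSpace.inclusionInDoubleDual 𝕜 X)

/-- Quasi-reflexive of order one, `dim (X** / X) = 1`: the canonical image of `X` in its bidual is
complemented by the line spanned by one vector outside it. -/
def IsQuasiReflexiveOfOrderOne (𝕜 X : Type*) [RCLike 𝕜] [NormedAddCommGroup X]
    [NormedSpace 𝕜 X] : Prop :=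
  ∃ ξ : StrongDual 𝕜 (StrongDual 𝕜 X),
    ξ ∉ Set.range (NormedSpace.inclusionInDoubleDual 𝕜 X) ∧
    ∀ φ : StrongDual 𝕜 (StrongDual 𝕜 X),
      ∃ (x : X) (c : 𝕜), φ = NormedSpace.inclusionInDoubleDual 𝕜 X x + c • ξ

/-- `D` is compact in the weak topology of `X`. -/
def IsWeaklyCompactSet (𝕜 : Type*) {X : Type*} [RCLike 𝕜] [NormedAddCommGroup X]
    [NormedSpace 𝕜 X] (D : Set X) : Prop :=
  IsCompact (toWeakSpace 𝕜 X '' D)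

/-- `V` maps the closed unit ball to a relatively weakly compact set. -/
def IsWeaklyCompactOperator {𝕜 X Y : Type*} [RCLike 𝕜] [NormedAddCommGroup X] [NormedSpace 𝕜 X]
    [NormedAddCommGroup Y] [NormedSpace 𝕜 Y] (V : X →L[𝕜] Y) : Prop :=
  IsCompact (closure (toWeakSpace 𝕜 Y '' (V '' Metric.closedBall 0 1)))

/-- `sup_{x ∈ D} ‖x - V x‖ < ε` (a strict inequality for the supremum). -/
def ApproximatesOn {𝕜 X : Type*} [RCLike 𝕜] [NormedAddCommGroup X] [NormedSpace 𝕜 X]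
    (V : X →L[𝕜] X) (D : Set X) (ε : ℝ) : Prop :=
  ∃ η < ε, ∀ x ∈ D, ‖x - V x‖ ≤ η

/-- The (bounded) weakly compact approximation property. -/
def HasWAP (𝕜 X : Type*) [RCLike 𝕜] [NormedAddCommGroup X] [NormedSpace 𝕜 X] : Prop :=
  ∃ C : ℝ, ∀ D : Set X, IsWeaklyCompactSet 𝕜 D → ∀ ε > 0,
    ∃ V : X →L[𝕜] X, IsWeaklyCompactOperator V ∧ ApproximatesOn V D ε ∧ ‖V‖ ≤ C

/-! ### The James-type space of a Schauder basis

All sequences are indexed from `0`. -/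

/-- `p 0 < q 0 < p 1 < q 1 < … < p (n-1) < q (n-1)`. -/
def IsPairChain {n : ℕ} (p q : Fin n → ℕ) : Prop :=
  (∀ i, p i < q i) ∧ ∀ i j, i < j → q i < p j

namespace JamesSpace

variable {𝕜 E : Type*} [RCLike 𝕜] [NormedAddCommGroup E] [NormedSpace 𝕜 E]

/-- `∑ (a_{p_j} - a_{q_j}) h_{p_j}` -/
def pairSum (h : ℕ → E) (a : ℕ → 𝕜) {n : ℕ} (p q : Fin n → ℕ) : E :=
  ∑ i, (a (p i) - a (q i)) • h (p i)

/-- The set of numbers `‖∑ (a_{p_j} - a_{q_j}) h_{p_j}‖` over all pair chains; the empty chain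
only contributes the value `0`. -/
def values (h : ℕ → E) (a : ℕ → 𝕜) : Set ℝ :=
  {r | ∃ (n : ℕ) (p q : Fin n → ℕ), IsPairChain p q ∧ r = ‖pairSum h a p q‖}

theorem zero_mem_values (h : ℕ → E) (a : ℕ → 𝕜) : (0 : ℝ) ∈ values h a :=
  ⟨0, Fin.elim0, Fin.elim0, ⟨fun i => i.elim0, fun i => i.elim0⟩, by simp [pairSum]⟩

theorem pairSum_add (h : ℕ → E) (a b : ℕ → 𝕜) {n : ℕ} (p q : Fin n → ℕ) :
    pairSum h (a + b) p q = pairSum h a p q + pairSum h b p q := by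
  simp only [pairSum, ← Finset.sum_add_distrib, ← add_smul, Pi.add_apply]
  exact Finset.sum_congr rfl fun i _ => by congr 1; ring

theorem pairSum_smul (h : ℕ → E) (c : 𝕜) (a : ℕ → 𝕜) {n : ℕ} (p q : Fin n → ℕ) :
    pairSum h (c • a) p q = c • pairSum h a p q := by
  simp only [pairSum, Finset.smul_sum, smul_smul, Pi.smul_apply, smul_eq_mul, mul_sub]

/-- The scalar sequences `a` with `lim a = 0` for which the supremum defining the norm is finite. -/
def toSubmodule (h : ℕ → E) : Submodule 𝕜 (ℕ → 𝕜) where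
  carrier := {a | Tendsto a atTop (𝓝 0) ∧ BddAbove (values h a)}
  zero_mem' := by
    refine ⟨tendsto_const_nhds, 0, ?_⟩
    rintro r ⟨n, p, q, -, rfl⟩
    simp [pairSum]
  add_mem' := by
    rintro a b ⟨ha, M, hM⟩ ⟨hb, N, hN⟩
    refine ⟨by simpa using! ha.add hb, M + N, ?_⟩
    rintro r ⟨n, p, q, hc, rfl⟩
    rw [pairSum_add]
    exact (norm_add_le _ _).trans
      (add_le_add (hM ⟨n, p, q, hc, rfl⟩) (hN ⟨n, p, q, hc, rfl⟩))
  smul_mem' := by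
    rintro c a ⟨ha, M, hM⟩
    refine ⟨by simpa using! ha.const_smul c, ‖c‖ * M, ?_⟩
    rintro r ⟨n, p, q, hc, rfl⟩
    rw [pairSum_smul, norm_smul]
    exact mul_le_mul_of_nonneg_left (hM ⟨n, p, q, hc, rfl⟩) (norm_nonneg c)

end JamesSpace

/-- The James-type space `J(h_j)`: the scalar sequences `a` with `lim a = 0` and
`sup ‖∑ (a_{p_j} - a_{q_j}) h_{p_j}‖ < ∞`, normed by this supremum. -/
def JamesSpace {𝕜 E : Type*} [RCLike 𝕜] [NormedAddCommGroup E] [NormedSpace 𝕜 E]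
    (h : SchauderBasis 𝕜 E) : Type _ :=
  ↥(JamesSpace.toSubmodule (𝕜 := 𝕜) h.basis)

namespace JamesSpace

variable {𝕜 E : Type*} [RCLike 𝕜] [NormedAddCommGroup E] [NormedSpace 𝕜 E]
  (h : SchauderBasis 𝕜 E)

instance : AddCommGroup (JamesSpace h) :=
  inferInstanceAs (AddCommGroup ↥(toSubmodule (𝕜 := 𝕜) h.basis))

instance : Module 𝕜 (JamesSpace h) :=
  inferInstanceAs (Module 𝕜 ↥(toSubmodule (𝕜 := 𝕜) h.basis))

/-- The underlying sequence, as a linear map. -/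
def seq : JamesSpace h →ₗ[𝕜] (ℕ → 𝕜) := (toSubmodule (𝕜 := 𝕜) h.basis).subtype

/-- Elements of `J(h_j)` are used as sequences `x 0, x 1, …`. -/
instance : CoeFun (JamesSpace h) (fun _ => ℕ → 𝕜) := ⟨fun x => seq h x⟩

instance : Norm (JamesSpace h) := ⟨fun x => sSup (values h.basis (seq h x))⟩

variable {h}

theorem norm_def (x : JamesSpace h) : ‖x‖ = sSup (values h.basis x) := rfl

theorem pairSum_le_norm (x : JamesSpace h) {n : ℕ} {p q : Fin n → ℕ} (hc : IsPairChain p q) :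
    ‖pairSum h.basis x p q‖ ≤ ‖x‖ :=
  le_csSup x.2.2 ⟨n, p, q, hc, rfl⟩

theorem norm_le {x : JamesSpace h} {M : ℝ}
    (hM : ∀ (n : ℕ) (p q : Fin n → ℕ), IsPairChain p q → ‖pairSum h.basis x p q‖ ≤ M) :
    ‖x‖ ≤ M := by
  refine csSup_le ⟨0, zero_mem_values _ _⟩ ?_
  rintro r ⟨n, p, q, hc, rfl⟩
  exact hM n p q hc

theorem coord_le_norm (x : JamesSpace h) (s : ℕ) : ‖x s‖ * ‖h s‖ ≤ ‖x‖ := by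
  have h0 : Tendsto (fun q => ‖x s - x q‖ * ‖h s‖) atTop (𝓝 (‖x s - 0‖ * ‖h s‖)) :=
    ((tendsto_const_nhds.sub x.2.1).norm).mul_const _
  rw [sub_zero] at h0
  refine le_of_tendsto h0 ?_
  filter_upwards [eventually_gt_atTop s] with q hq
  have := pairSum_le_norm x (n := 1) (p := fun _ => s) (q := fun _ => q)
    ⟨fun _ => hq, fun i j hij => by omega⟩
  simpa [pairSum, norm_smul] using this

theorem basis_ne_zero (h : SchauderBasis 𝕜 E) (s : ℕ) : h s ≠ 0 := h.linearIndependent.ne_zero s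

theorem core (h : SchauderBasis 𝕜 E) : NormedSpace.Core 𝕜 (JamesSpace h) where
  norm_nonneg x := le_csSup x.2.2 (zero_mem_values _ _)
  norm_smul c x := by
    have key : ∀ (c : 𝕜) (x : JamesSpace h), ‖c • x‖ ≤ ‖c‖ * ‖x‖ := fun c x =>
      norm_le fun n p q hc => by
        rw [map_smul, pairSum_smul, norm_smul]
        exact mul_le_mul_of_nonneg_left (pairSum_le_norm x hc) (norm_nonneg c)
    rcases eq_or_ne c 0 with rfl | hc
    · refine le_antisymm (key 0 x) ?_
      rw [norm_zero, zero_mul]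
      exact le_csSup (0 • x : JamesSpace h).2.2 (zero_mem_values _ _)
    · refine le_antisymm (key c x) ?_
      have h1 := key c⁻¹ (c • x)
      rw [inv_smul_smul₀ hc, norm_inv] at h1
      have hc' : 0 < ‖c‖ := norm_pos_iff.2 hc
      rwa [inv_mul_eq_div, le_div_iff₀ hc', mul_comm] at h1
  norm_triangle x y := norm_le fun n p q hc => by
    rw [map_add, pairSum_add]
    exact (norm_add_le _ _).trans (add_le_add (pairSum_le_norm x hc) (pairSum_le_norm y hc))
  norm_eq_zero_iff x := by
    refine ⟨fun hx => Subtype.ext (funext fun s => ?_), ?_⟩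
    · have h1 := coord_le_norm x s
      rw [hx] at h1
      have h2 : 0 < ‖h s‖ := norm_pos_iff.2 (basis_ne_zero h s)
      exact norm_le_zero_iff.1 (nonpos_of_mul_nonpos_left h1 h2)
    · rintro rfl
      refine le_antisymm (norm_le fun n p q _ => ?_) (le_csSup (0 : JamesSpace h).2.2
        (zero_mem_values _ _))
      simp [pairSum]

instance : NormedAddCommGroup (JamesSpace h) := NormedAddCommGroup.ofCore (core h)

instance : NormedSpace 𝕜 (JamesSpace h) := NormedSpace.ofCore (core h)

theorem single_mem (h : ℕ → E) (i : ℕ) : (Pi.single i 1 : ℕ → 𝕜) ∈ toSubmodule (𝕜 := 𝕜) h := by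
  refine ⟨tendsto_const_nhds.congr' ?_, ∑ j ∈ Finset.range (i + 1), ‖h j‖, ?_⟩
  · filter_upwards [eventually_gt_atTop i] with n hn
    rw [Pi.single_eq_of_ne hn.ne']
  · rintro r ⟨n, p, q, ⟨hpq, hqp⟩, rfl⟩
    have hp : Function.Injective p := by
      refine StrictMono.injective fun k l hkl => ?_
      exact (hpq k).trans (hqp k l hkl)
    have hle : ∀ k, ‖((Pi.single i 1 : ℕ → 𝕜) (p k) - (Pi.single i 1 : ℕ → 𝕜) (q k)) • h (p k)‖
        ≤ if p k ∈ Finset.range (i + 1) then ‖h (p k)‖ else 0 := by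
      intro k
      have := hpq k
      rw [norm_smul]
      split_ifs with hk
      · refine mul_le_of_le_one_left (norm_nonneg _) ?_
        by_cases h1 : p k = i
        · rw [h1, Pi.single_eq_same, Pi.single_eq_of_ne (by omega)]; simp
        · rw [Pi.single_eq_of_ne h1]
          by_cases h2 : q k = i
          · rw [h2, Pi.single_eq_same]; simp
          · rw [Pi.single_eq_of_ne h2]; simp
      · rw [Finset.mem_range] at hk
        rw [Pi.single_eq_of_ne (by omega), Pi.single_eq_of_ne (by omega)]; simp
    calc _ ≤ ∑ k, if p k ∈ Finset.range (i + 1) then ‖h (p k)‖ else 0 :=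
          norm_sum_le_of_le _ fun k _ => hle k
      _ = ∑ j ∈ Finset.univ.image p, if j ∈ Finset.range (i + 1) then ‖h j‖ else 0 :=
          (Finset.sum_image (f := fun j => if j ∈ Finset.range (i + 1) then ‖h j‖ else 0)
            hp.injOn).symm
      _ = ∑ j ∈ Finset.univ.image p with j ∈ Finset.range (i + 1), ‖h j‖ :=
          (Finset.sum_filter _ _).symm
      _ ≤ _ := Finset.sum_le_sum_of_subset_of_nonneg
          (fun j hj => (Finset.mem_filter.1 hj).2) fun _ _ _ => norm_nonneg _

variable (h)

/-- The unit vector `e_i` of `J(h_j)`. -/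
def unitVec (i : ℕ) : JamesSpace h := ⟨Pi.single i 1, single_mem h.basis i⟩

end JamesSpace

/-! ### Block averages and the shifted operators -/

/-- A convex combination of the averages over the successive subintervals
`[n 0, n 1), …, [n (k-1), n k)` of a partition of the integer interval `[a, b)`. -/
structure BlockAverage (a b : ℕ) where
  /-- the number of subintervals -/
  k : ℕ
  /-- the endpoints of the subintervals -/
  n : Fin (k + 1) → ℕ
  strictMono : StrictMono n
  first : n 0 = a
  last : n (Fin.last k) = b
  /-- the weights -/
  weight : Fin k → ℝ
  weight_nonneg : ∀ r, 0 ≤ weight r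
  weight_sum : ∑ r, weight r = 1

/-- The functional `∑_r α_r · (1 / (n_{r+1} - n_r)) ∑_{n_r ≤ s < n_{r+1}} x(s)`. -/
def BlockAverage.eval {𝕜 : Type*} [RCLike 𝕜] {a b : ℕ} (A : BlockAverage a b) (x : ℕ → 𝕜) : 𝕜 :=
  ∑ r : Fin A.k, (A.weight r : 𝕜) *
    (((A.n r.succ : 𝕜) - (A.n r.castSucc : 𝕜))⁻¹ *
      ∑ s ∈ Finset.Ico (A.n r.castSucc) (A.n r.succ), x s)

/-- A partition of the indices into successive intervals `I_j = [t j, t (j+1))`, together with a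
convex combination of block averages on each of them. -/
structure BlockScheme where
  /-- the endpoints of the intervals -/
  t : ℕ → ℕ
  strictMono : StrictMono t
  zero : t 0 = 0
  /-- the averaging functional on `I_j` -/
  avg : ∀ j, BlockAverage (t j) (t (j + 1))

namespace BlockScheme

variable {𝕜 E : Type*} [RCLike 𝕜] [NormedAddCommGroup E] [NormedSpace 𝕜 E]

/-- The vectors onto which the averages are shifted: the average over `I_0` multiplies `e_0`, the
average over `I_1` multiplies the indicator of `I_0 \ {0}`, and the average over `I_{j+1}` multiplies
the indicator of `I_j` for `j ≥ 1`. -/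
def shiftVec (S : BlockScheme) (h : SchauderBasis 𝕜 E) : ℕ → JamesSpace h
  | 0 => JamesSpace.unitVec h 0
  | 1 => ∑ s ∈ Finset.Ico 1 (S.t 1), JamesSpace.unitVec h s
  | j + 2 => ∑ s ∈ Finset.Ico (S.t (j + 1)) (S.t (j + 2)), JamesSpace.unitVec h s

/-- `W` is the shifted sum of block averages: `W x` is the norm limit of the partial sums of
`∑_j V_j(x) s_j`, with `V_j` the averaging functional on `I_j` and `s_j` the shifted vectors. -/
def IsShiftedSum (S : BlockScheme) (h : SchauderBasis 𝕜 E)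
    (W : JamesSpace h →L[𝕜] JamesSpace h) : Prop :=
  ∀ x : JamesSpace h, Tendsto
    (fun N => ∑ j ∈ Finset.range N, (S.avg j).eval (x : ℕ → 𝕜) • S.shiftVec h j) atTop (𝓝 (W x))

end BlockScheme

/-- On every weakly compact set the identity of `J(h_j)` is approximated by weakly compact operators
of the form `I` minus a shifted sum of convex combinations of block averages, with norm at most `C`. -/
def HasBlockApproximation {𝕜 E : Type*} [RCLike 𝕜] [NormedAddCommGroup E] [NormedSpace 𝕜 E]
    (h : SchauderBasis 𝕜 E) (C : ℝ) : Prop :=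
  ∀ D : Set (JamesSpace h), IsWeaklyCompactSet 𝕜 D → ∀ ε > 0,
    ∃ (S : BlockScheme) (W : JamesSpace h →L[𝕜] JamesSpace h),
      S.IsShiftedSum h W ∧
      IsWeaklyCompactOperator (ContinuousLinearMap.id 𝕜 (JamesSpace h) - W) ∧
      ApproximatesOn (ContinuousLinearMap.id 𝕜 (JamesSpace h) - W) D ε ∧
      ‖ContinuousLinearMap.id 𝕜 (JamesSpace h) - W‖ ≤ C

/-! ### The normalization of the basis under which the bound is explicit -/

/-- `1`-unconditionality: multiplying coefficients by scalars of modulus one preserves the norm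
(over the reals these are the signs). -/
def IsOneUnconditional {𝕜 E : Type*} [RCLike 𝕜] [NormedAddCommGroup E] [NormedSpace 𝕜 E]
    (h : SchauderBasis 𝕜 E) : Prop :=
  ∀ (N : ℕ) (a θ : ℕ → 𝕜), (∀ j, ‖θ j‖ = 1) →
    ‖∑ j ∈ Finset.range N, (θ j * a j) • h j‖ = ‖∑ j ∈ Finset.range N, a j • h j‖

/-- Right dominance with constant `2`:
`‖∑ a_i h_{m(i)}‖ ≤ 2 ‖∑ a_i h_{n(i)}‖` whenever `m(0) ≤ n(0) < m(1) ≤ n(1) < …`. -/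
def IsRightDominant {𝕜 E : Type*} [RCLike 𝕜] [NormedAddCommGroup E] [NormedSpace 𝕜 E]
    (h : SchauderBasis 𝕜 E) : Prop :=
  ∀ m n : ℕ → ℕ, (∀ i, m i ≤ n i) → (∀ i, n i < m (i + 1)) → ∀ (N : ℕ) (a : ℕ → 𝕜),
    ‖∑ i ∈ Finset.range N, a i • h (m i)‖ ≤ 2 * ‖∑ i ∈ Finset.range N, a i • h (n i)‖

end

/-- **Mazur's theorem for pointwise null sequences.** A uniformly bounded sequence of nonnegative
continuous functions on a compact space that tends to zero pointwise has convex combinations of its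
tails that are uniformly small. -/
theorem exists_convexCombination_le {X : Type*} [TopologicalSpace X] [CompactSpace X] [T2Space X]
    {g : ℕ → X → ℝ} (hg : ∀ n, Continuous (g n)) (h0 : ∀ n x, 0 ≤ g n x) {C : ℝ}
    (hC : ∀ n x, g n x ≤ C) (hlim : ∀ x, Tendsto (fun n => g n x) atTop (𝓝 0))
    (N : ℕ) {ε : ℝ} (hε : 0 < ε) :
    ∃ b > N, ∃ w : ℕ → ℝ, (∀ n, 0 ≤ w n) ∧ ∑ n ∈ Finset.Ico N b, w n = 1 ∧
      ∀ x, ∑ n ∈ Finset.Ico N b, w n * g n x ≤ ε := by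
  classical
  let G : ℕ → C(X, ℝ) := fun n => ⟨g n, hg n⟩
  let U : Set C(X, ℝ) := {f | ∀ x, f x < ε}
  let A : Set C(X, ℝ) := convexHull ℝ (Set.range fun n => G (n + N))
  have hUo : IsOpen U := by
    have : U = {f : C(X, ℝ) | Set.MapsTo f Set.univ (Set.Iio ε)} := by
      ext f; simp [U, Set.MapsTo]
    rw [this]
    exact ContinuousMap.isOpen_setOfPred_mapsTo isCompact_univ isOpen_Iio
  have hUc : Convex ℝ U := by
    intro f hf k hk a b ha hb hab x
    have h1 := hf x
    have h2 := hk x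
    simp only [ContinuousMap.add_apply, ContinuousMap.smul_apply, smul_eq_mul]
    exact (convex_Iio ε) h1 h2 ha hb hab
  by_cases hdisj : Disjoint U A
  · exfalso
    obtain ⟨Λ, u, hΛU, hΛA⟩ := geometric_hahn_banach_open hUc hUo (convex_convexHull ℝ _) hdisj
    have hu : 0 < u := by
      have : (0 : C(X, ℝ)) ∈ U := fun x => by simpa using hε
      simpa using hΛU 0 this
    have hpos : ∀ f : C(X, ℝ), 0 ≤ f → 0 ≤ Λ f := by
      intro f hf
      by_contra! hneg
      have hmem : (u / Λ f) • f ∈ U := fun x => by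
        have h1 : 0 ≤ f x := hf x
        have h2 : u / Λ f ≤ 0 := div_nonpos_of_nonneg_of_nonpos hu.le hneg.le
        simp only [ContinuousMap.smul_apply, smul_eq_mul]
        exact lt_of_le_of_lt (mul_nonpos_of_nonpos_of_nonneg h2 h1) hε
      have := hΛU _ hmem
      rw [map_smul, smul_eq_mul, div_mul_cancel₀ _ hneg.ne] at this
      exact lt_irrefl _ this
    let L : CompactlySupportedContinuousMap X ℝ →ₗ[ℝ] ℝ :=
      { toFun := fun f => Λ f.toContinuousMap
        map_add' := fun f k => map_add Λ f.toContinuousMap k.toContinuousMap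
        map_smul' := fun c f => map_smul Λ c f.toContinuousMap }
    let P : CompactlySupportedContinuousMap X ℝ →ₚ[ℝ] ℝ :=
      PositiveLinearMap.mk₀ L fun f hf => hpos _ hf
    let _ : MeasurableSpace X := borel X
    have : BorelSpace X := ⟨rfl⟩
    let μ := RealRMK.rieszMeasure P
    have hint : ∀ f : C(X, ℝ), ∫ x, f x ∂μ = Λ f := fun f =>
      RealRMK.integral_rieszMeasure P (CompactlySupportedContinuousMap.continuousMapEquiv f)
    have hdc : Tendsto (fun n => ∫ x, G n x ∂μ) atTop (𝓝 (∫ _, (0 : ℝ) ∂μ)) := by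
      refine MeasureTheory.tendsto_integral_of_dominated_convergence (fun _ => C)
        (fun n => (hg n).aestronglyMeasurable) (MeasureTheory.integrable_const _) ?_ ?_
      · intro n
        filter_upwards with x
        rw [Real.norm_eq_abs]
        exact (abs_of_nonneg (h0 n x)).trans_le (hC n x)
      · filter_upwards with x using hlim x
    simp only [hint, MeasureTheory.integral_zero] at hdc
    have hge : ∀ n ≥ N, u ≤ Λ (G n) := fun n hn => by
      refine hΛA _ (subset_convexHull ℝ _ ⟨n - N, ?_⟩)
      simp only [Nat.sub_add_cancel hn]
    have := ge_of_tendsto hdc (eventually_atTop.2 ⟨N, hge⟩)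
    exact absurd this (not_le.2 hu)
  · obtain ⟨f, hfU, hfA⟩ := Set.not_disjoint_iff.1 hdisj
    simp only [A, convexHull_range_eq_exists_affineCombination] at hfA
    obtain ⟨s, w, hw0, hw1, rfl⟩ := hfA
    rw [Finset.affineCombination_eq_linear_combination _ _ _ hw1] at hfU
    have key : ∀ F : ℕ → ℝ, ∑ n ∈ Finset.Ico N (N + (s.sup id + 1)),
        (if n - N ∈ s then w (n - N) else 0) * F n = ∑ i ∈ s, w i * F (i + N) := by
      intro F
      rw [Finset.sum_Ico_eq_sum_range, Nat.add_sub_cancel_left]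
      have hs : s ⊆ Finset.range (s.sup id + 1) := fun i hi =>
        Finset.mem_range.2 (Nat.lt_succ_of_le (Finset.le_sup (f := id) hi))
      rw [← Finset.sum_subset hs]
      · exact Finset.sum_congr rfl fun i hi => by simp [hi, add_comm]
      · intro i _ hi
        simp [hi]
    refine ⟨N + (s.sup id + 1), by omega, fun n => if n - N ∈ s then w (n - N) else 0, ?_, ?_, ?_⟩
    · intro n
      dsimp only
      split_ifs with hn
      exacts [hw0 _ hn, le_rfl]
    · simpa [hw1] using key fun _ => 1
    · intro x
      rw [key]
      have := hfU x
      simp only [ContinuousMap.coe_sum, Finset.sum_apply, ContinuousMap.smul_apply,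
        smul_eq_mul] at this
      exact this.le

section Reflexive

variable {𝕜 E : Type*} [RCLike 𝕜] [NormedAddCommGroup E] [NormedSpace 𝕜 E]

/-- A bounded family in a dual space has a weak-star cluster point along every nontrivial filter. -/
theorem exists_dual_mapClusterPt {α : Type*} {l : Filter α} [l.NeBot] (f : α → StrongDual 𝕜 E)
    {M : ℝ} (hM : ∀ a, ‖f a‖ ≤ M) :
    ∃ ζ : StrongDual 𝕜 E, ‖ζ‖ ≤ M ∧ ∀ x, MapClusterPt (ζ x) l fun a => f a x := by
  have hK := WeakDual.isCompact_closedBall (𝕜 := 𝕜) (0 : StrongDual 𝕜 E) M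
  obtain ⟨ζ, hζ, hcl⟩ := hK.exists_mapClusterPt
    (u := fun a => StrongDual.toWeakDual (f a)) (f := l) (by
      refine tendsto_principal.2 (Eventually.of_forall fun a => ?_)
      simpa using! hM a)
  refine ⟨WeakDual.toStrongDual ζ, by simpa using hζ, fun x => ?_⟩
  exact hcl.continuousAt_comp (WeakDual.eval_continuous x).continuousAt

theorem IsReflexiveSpace.exists_mapClusterPt (hE : IsReflexiveSpace 𝕜 E) {α : Type*}
    {l : Filter α} [l.NeBot] (v : α → E) {M : ℝ} (hM : ∀ a, ‖v a‖ ≤ M) :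
    ∃ z : E, ∀ g : StrongDual 𝕜 E, MapClusterPt (g z) l fun a => g (v a) := by
  obtain ⟨ζ, -, hζ⟩ := exists_dual_mapClusterPt (l := l)
    (fun a => NormedSpace.inclusionInDoubleDual 𝕜 E (v a)) (M := M)
    fun a => (NormedSpace.double_dual_bound 𝕜 E _).trans (hM a)
  obtain ⟨z, rfl⟩ := hE ζ
  exact ⟨z, hζ⟩

theorem MapClusterPt.eq_of_tendsto {α X : Type*} [TopologicalSpace X] [T2Space X] {l : Filter α}
    {f : α → X} {a b : X} (h : MapClusterPt a l f) (hb : Tendsto f l (𝓝 b)) : a = b := by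
  by_contra hne
  have := h.clusterPt.mono hb
  exact hne (eq_of_nhds_neBot this)

theorem SchauderBasis.eq_zero_of_coord (h : SchauderBasis 𝕜 E) {z : E}
    (hz : ∀ j, h.coord j z = 0) : z = 0 := by
  refine tendsto_nhds_unique (SchauderBasis.tendsto_proj h z) ?_
  simp [hz]

theorem SchauderBasis.coord_sum_range (h : SchauderBasis 𝕜 E) (b : ℕ → 𝕜) (N j : ℕ) :
    h.coord j (∑ i ∈ Finset.range N, b i • h i) = if j < N then b j else 0 := by
  simp [h.ortho, Pi.single_apply]

/-- A Schauder basis of a reflexive space is boundedly complete. -/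
theorem IsReflexiveSpace.exists_tendsto_sum (hE : IsReflexiveSpace 𝕜 E) (h : SchauderBasis 𝕜 E)
    (b : ℕ → 𝕜) {M : ℝ} (hM : ∀ N, ‖∑ i ∈ Finset.range N, b i • h i‖ ≤ M) :
    ∃ z : E, Tendsto (fun N => ∑ i ∈ Finset.range N, b i • h i) atTop (𝓝 z) := by
  obtain ⟨z, hz⟩ := hE.exists_mapClusterPt (l := atTop) _ hM
  have hb : ∀ j, h.coord j z = b j := fun j => by
    refine (hz (h.coord j)).eq_of_tendsto (tendsto_const_nhds.congr' ?_)
    filter_upwards [eventually_gt_atTop j] with N hN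
    rw [SchauderBasis.coord_sum_range, if_pos hN]
  refine ⟨z, ?_⟩
  simpa [hb] using SchauderBasis.tendsto_proj h z

/-- In a reflexive space with a Schauder basis, bounded coordinatewise null sequences are weakly
null. -/
theorem IsReflexiveSpace.tendsto_dual_of_coord (hE : IsReflexiveSpace 𝕜 E)
    (h : SchauderBasis 𝕜 E) {v : ℕ → E} {M : ℝ} (hM : ∀ n, ‖v n‖ ≤ M)
    (hv : ∀ j, Tendsto (fun n => h.coord j (v n)) atTop (𝓝 0)) (g : StrongDual 𝕜 E) :
    Tendsto (fun n => g (v n)) atTop (𝓝 0) := by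
  refine tendsto_of_subseq_tendsto fun ns hns => ?_
  obtain ⟨z, hz⟩ := hE.exists_mapClusterPt (l := atTop) (fun n => v (ns n)) fun n => hM _
  have h0 : z = 0 := h.eq_zero_of_coord fun j => (hz (h.coord j)).eq_of_tendsto ((hv j).comp hns)
  have := hz g
  rw [h0, map_zero] at this
  obtain ⟨ψ, hψ, hlim⟩ := this.tendsto_subseq
  exact ⟨ψ, hlim⟩

end Reflexive

namespace JamesSpace

variable {𝕜 E : Type*} [RCLike 𝕜] [NormedAddCommGroup E] [NormedSpace 𝕜 E]

/-! ### Chains indexed by finite sets -/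

/-- The pairs `(p, Q p)`, `p ∈ S`, in increasing order form a pair chain. -/
structure IsChainOn (S : Finset ℕ) (Q : ℕ → ℕ) : Prop where
  lt : ∀ p ∈ S, p < Q p
  next : ∀ p ∈ S, ∀ p' ∈ S, p < p' → Q p < p'

theorem IsChainOn.mono {S T : Finset ℕ} {Q : ℕ → ℕ} (h : IsChainOn S Q) (hT : T ⊆ S) :
    IsChainOn T Q :=
  ⟨fun p hp => h.lt p (hT hp), fun p hp p' hp' => h.next p (hT hp) p' (hT hp')⟩

/-- `∑ (a_p - a_{Q p}) h_p` over `p ∈ S`. -/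
def chainSum (h : ℕ → E) (a : ℕ → 𝕜) (S : Finset ℕ) (Q : ℕ → ℕ) : E :=
  ∑ p ∈ S, (a p - a (Q p)) • h p

theorem chainSum_add (h : ℕ → E) (a b : ℕ → 𝕜) (S : Finset ℕ) (Q : ℕ → ℕ) :
    chainSum h (a + b) S Q = chainSum h a S Q + chainSum h b S Q := by
  simp only [chainSum, ← Finset.sum_add_distrib, ← add_smul, Pi.add_apply]
  exact Finset.sum_congr rfl fun i _ => by congr 1; ring

theorem chainSum_smul (h : ℕ → E) (c : 𝕜) (a : ℕ → 𝕜) (S : Finset ℕ) (Q : ℕ → ℕ) :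
    chainSum h (c • a) S Q = c • chainSum h a S Q := by
  simp only [chainSum, Finset.smul_sum, smul_smul, Pi.smul_apply, smul_eq_mul, mul_sub]

theorem IsChainOn.exists_pairSum_eq {S : Finset ℕ} {Q : ℕ → ℕ} (hc : IsChainOn S Q)
    (h : ℕ → E) (a : ℕ → 𝕜) :
    ∃ (n : ℕ) (p q : Fin n → ℕ), IsPairChain p q ∧ pairSum h a p q = chainSum h a S Q := by
  refine ⟨S.card, S.orderEmbOfFin rfl, fun i => Q (S.orderEmbOfFin rfl i), ⟨fun i => ?_,
    fun i j hij => ?_⟩, ?_⟩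
  · exact hc.lt _ (S.orderEmbOfFin_mem rfl i)
  · exact hc.next _ (S.orderEmbOfFin_mem rfl i) _ (S.orderEmbOfFin_mem rfl j)
      ((S.orderEmbOfFin rfl).strictMono hij)
  · unfold pairSum chainSum
    conv_rhs => rw [← S.image_orderEmbOfFin_univ rfl]
    rw [Finset.sum_image (S.orderEmbOfFin rfl).injective.injOn]

theorem _root_.IsPairChain.exists_chainSum_eq {n : ℕ} {p q : Fin n → ℕ} (hc : IsPairChain p q)
    (h : ℕ → E) (a : ℕ → 𝕜) :
    ∃ (S : Finset ℕ) (Q : ℕ → ℕ), IsChainOn S Q ∧ chainSum h a S Q = pairSum h a p q := by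
  have hmono : StrictMono p := fun k l hkl => (hc.1 k).trans (hc.2 k l hkl)
  have hQ : ∀ i, Function.extend p q 0 (p i) = q i := fun i => hmono.injective.extend_apply _ _ _
  refine ⟨Finset.univ.image p, Function.extend p q 0, ⟨?_, ?_⟩, ?_⟩
  · simp only [Finset.mem_image, Finset.mem_univ, true_and, forall_exists_index]
    rintro _ i rfl
    rw [hQ]
    exact hc.1 i
  · simp only [Finset.mem_image, Finset.mem_univ, true_and, forall_exists_index]
    rintro _ i rfl _ j rfl hij
    rw [hQ]
    exact hc.2 i j (hmono.lt_iff_lt.1 hij)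
  · unfold chainSum pairSum
    rw [Finset.sum_image hmono.injective.injOn]
    simp only [hQ]

/-- All chain sums of the sequence `a` have norm at most `M`. -/
def ChainBound (h : ℕ → E) (a : ℕ → 𝕜) (M : ℝ) : Prop :=
  ∀ ⦃S : Finset ℕ⦄ ⦃Q : ℕ → ℕ⦄, IsChainOn S Q → ‖chainSum h a S Q‖ ≤ M

theorem ChainBound.mem_upperBounds {h : ℕ → E} {a : ℕ → 𝕜} {M : ℝ} (hb : ChainBound h a M) :
    M ∈ upperBounds (values h a) := by
  rintro r ⟨n, p, q, hc, rfl⟩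
  obtain ⟨S, Q, hS, he⟩ := hc.exists_chainSum_eq h a
  exact he ▸ hb hS

variable {h : SchauderBasis 𝕜 E}

theorem norm_chainSum_le (x : JamesSpace h) : ChainBound h x ‖x‖ := by
  intro S Q hc
  obtain ⟨n, p, q, hpq, he⟩ := hc.exists_pairSum_eq h x
  exact he ▸ pairSum_le_norm x hpq

theorem exists_seq_eq {a : ℕ → 𝕜} {M : ℝ} (ha : Tendsto a atTop (𝓝 0)) (hb : ChainBound h a M) :
    ∃ x : JamesSpace h, seq h x = a ∧ ‖x‖ ≤ M :=
  ⟨⟨a, ha, M, hb.mem_upperBounds⟩, rfl,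
    csSup_le ⟨0, zero_mem_values _ _⟩ hb.mem_upperBounds⟩

theorem norm_le_of_chainBound {x : JamesSpace h} {M : ℝ} (hb : ChainBound h x M) : ‖x‖ ≤ M :=
  csSup_le ⟨0, zero_mem_values _ _⟩ hb.mem_upperBounds

theorem seq_injective : Function.Injective (seq h) := Subtype.val_injective

theorem tendsto_seq (x : JamesSpace h) : Tendsto (seq h x) atTop (𝓝 0) := x.2.1

/-- In the reflexive case, chain sums far out are uniformly small. -/
theorem ChainBound.exists_tail_le (hE : IsReflexiveSpace 𝕜 E) {a : ℕ → 𝕜} {M : ℝ}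
    (hb : ChainBound h a M) {ε : ℝ} (hε : 0 < ε) :
    ∃ n, ∀ S Q, IsChainOn S Q → (∀ p ∈ S, n ≤ p) → ‖chainSum h a S Q‖ ≤ ε := by
  classical
  by_contra! hcon
  choose S Q hc hS hbig using hcon
  let next : ℕ → ℕ := fun n => n + 1 + (S n).sup (Q n)
  have hQnext : ∀ n, ∀ p ∈ S n, Q n p < next n := fun n p hp => by
    have := Finset.le_sup (f := Q n) hp
    simp only [next]; omega
  let N : ℕ → ℕ := fun k => next^[k] 0
  have hN : ∀ k, N (k + 1) = next (N k) := fun k => Function.iterate_succ_apply' _ _ _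
  have hNlt : StrictMono N := strictMono_nat_of_lt_succ fun k => by
    rw [hN]; simp only [next]; omega
  let κ : ℕ → ℕ := fun p => Nat.findGreatest (fun k => N k ≤ p) p
  have hκ : ∀ k p, N k ≤ p → p < N (k + 1) → κ p = k := by
    intro k p h1 h2
    have h3 : N (κ p) ≤ p := Nat.findGreatest_spec (P := fun k => N k ≤ p)
      (hNlt.le_apply.trans h1) h1
    have h4 : k ≤ κ p := Nat.le_findGreatest (hNlt.le_apply.trans h1) h1
    have h5 : κ p < k + 1 := hNlt.lt_iff_lt.1 (h3.trans_lt h2)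
    omega
  have hSκ : ∀ k, ∀ p ∈ S (N k), κ p = k := fun k p hp => hκ k p (hS _ p hp) (by
    rw [hN]; exact ((hc _).lt p hp).trans (hQnext _ p hp))
  let Q' : ℕ → ℕ := fun p => Q (N (κ p)) p
  let b : ℕ → 𝕜 := fun p => if p ∈ S (N (κ p)) then a p - a (Q' p) else 0
  have hsum : ∀ T : Finset ℕ,
      ∑ p ∈ T, b p • h p = chainSum h a (T.filter fun p => p ∈ S (N (κ p))) Q' := by
    intro T
    simp only [b, ite_smul, zero_smul, chainSum, Finset.sum_filter]
  have hchain : ∀ T : Finset ℕ, IsChainOn (T.filter fun p => p ∈ S (N (κ p))) Q' := by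
    intro T
    refine ⟨fun p hp => (hc _).lt p (Finset.mem_filter.1 hp).2, fun p hp p' hp' hlt => ?_⟩
    have h1 := (Finset.mem_filter.1 hp).2
    have h2 := (Finset.mem_filter.1 hp').2
    have h3 : κ p ≤ κ p' := by
      by_contra! hlt'
      have := hNlt.monotone (Nat.succ_le_of_lt hlt')
      have h4 := hS _ _ h1
      have h5 := (hc _).lt _ h2
      have h6 := hQnext _ _ h2
      rw [← hN] at h6
      simp only [Nat.succ_eq_add_one] at this
      omega
    rcases h3.eq_or_lt with heq | hlt'
    · simp only [Q']
      rw [← heq] at h2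
      exact (hc _).next p h1 p' h2 hlt
    · have h4 := hQnext _ _ h1
      rw [← hN] at h4
      exact h4.trans_le ((hNlt.monotone (Nat.succ_le_of_lt hlt')).trans (hS _ _ h2))
  obtain ⟨z, hz⟩ := hE.exists_tendsto_sum h b (M := M) fun n => by
    rw [hsum]; exact hb (hchain _)
  have hcauchy := Metric.cauchySeq_iff.1 hz.cauchySeq ε hε
  obtain ⟨n0, hn0⟩ := hcauchy
  have h1 := hn0 (N (n0 + 1)) ((Nat.le_succ n0).trans hNlt.le_apply) (N n0) hNlt.le_apply
  rw [dist_eq_norm, ← Finset.sum_Ico_eq_sub _ (hNlt.monotone (Nat.le_succ n0)), hsum] at h1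
  have h2 : (Finset.Ico (N n0) (N (n0 + 1))).filter (fun p => p ∈ S (N (κ p))) = S (N n0) := by
    ext p
    simp only [Finset.mem_filter, Finset.mem_Ico]
    constructor
    · rintro ⟨⟨h3, h4⟩, h5⟩
      rwa [hκ n0 p h3 h4] at h5
    · intro hp
      refine ⟨⟨hS _ p hp, ?_⟩, by rwa [hSκ _ p hp]⟩
      rw [hN]; exact ((hc _).lt p hp).trans (hQnext _ p hp)
  rw [h2] at h1
  have h3 : chainSum h a (S (N n0)) Q' = chainSum h a (S (N n0)) (Q (N n0)) :=
    Finset.sum_congr rfl fun p hp => by simp only [Q', hSκ _ p hp]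
  rw [h3] at h1
  exact absurd h1 (not_lt.2 (hbig (N n0)).le)

theorem ChainBound.exists_tendsto (hE : IsReflexiveSpace 𝕜 E) (hnorm : ∀ j, ‖h j‖ = 1)
    {a : ℕ → 𝕜} {M : ℝ} (hb : ChainBound h a M) : ∃ c, Tendsto a atTop (𝓝 c) := by
  refine cauchySeq_tendsto_of_complete (Metric.cauchySeq_iff'.2 fun ε hε => ?_)
  obtain ⟨n, hn⟩ := hb.exists_tail_le hE (half_pos hε)
  refine ⟨n, fun q hq => ?_⟩
  rcases hq.eq_or_lt with rfl | hlt
  · simpa using hε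
  have := hn {n} (fun _ => q) ⟨by simpa using hlt, by simp⟩ (by simp)
  rw [chainSum, Finset.sum_singleton, norm_smul, hnorm, mul_one] at this
  rw [dist_comm, dist_eq_norm]
  linarith

end JamesSpace

namespace JamesSpace

variable {𝕜 E : Type*} [RCLike 𝕜] [NormedAddCommGroup E] [NormedSpace 𝕜 E]
  {h : SchauderBasis 𝕜 E}

/-! ### Completeness -/

theorem ChainBound.of_tendsto {h : ℕ → E} {a : ℕ → ℕ → 𝕜} {b : ℕ → 𝕜} {M : ℝ}
    (ha : ∀ᶠ k in atTop, ChainBound h (a k) M)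
    (hab : ∀ s, Tendsto (fun k => a k s) atTop (𝓝 (b s))) :
    ChainBound h b M := by
  intro S Q hc
  have : Tendsto (fun k => chainSum h (a k) S Q) atTop (𝓝 (chainSum h b S Q)) :=
    tendsto_finsetSum _ fun p _ => ((hab p).sub (hab (Q p))).smul_const _
  refine le_of_tendsto this.norm ?_
  filter_upwards [ha] with k hk using hk hc

theorem norm_seq_le (hnorm : ∀ j, ‖h j‖ = 1) (x : JamesSpace h) (s : ℕ) : ‖seq h x s‖ ≤ ‖x‖ := by
  simpa [hnorm] using coord_le_norm x s

theorem completeSpace (hnorm : ∀ j, ‖h j‖ = 1) : CompleteSpace (JamesSpace h) := by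
  refine Metric.complete_of_cauchySeq_tendsto fun u hu => ?_
  rw [Metric.cauchySeq_iff] at hu
  have hcoord : ∀ s, ∃ c, Tendsto (fun k => seq h (u k) s) atTop (𝓝 c) := fun s => by
    refine cauchySeq_tendsto_of_complete (Metric.cauchySeq_iff.2 fun ε hε => ?_)
    obtain ⟨N, hN⟩ := hu ε hε
    refine ⟨N, fun m hm n hn => lt_of_le_of_lt ?_ (hN m hm n hn)⟩
    rw [dist_eq_norm, dist_eq_norm]
    simpa using norm_seq_le hnorm (u m - u n) s
  choose a ha using hcoord
  have hdiff : ∀ ε > 0, ∃ N, ∀ n ≥ N, ChainBound h (a - seq h (u n)) ε ∧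
      ∀ s, ‖a s - seq h (u n) s‖ ≤ ε := by
    intro ε hε
    obtain ⟨N, hN⟩ := hu ε hε
    have hN' : ∀ n ≥ N, ∀ᶠ k in atTop, ‖u k - u n‖ ≤ ε := fun n hn => by
      filter_upwards [eventually_ge_atTop N] with k hk
      rw [← dist_eq_norm]
      exact (hN k hk n hn).le
    refine ⟨N, fun n hn => ⟨ChainBound.of_tendsto (a := fun k => seq h (u k) - seq h (u n)) ?_
      fun s => (ha s).sub_const _, fun s => ?_⟩⟩
    · filter_upwards [hN' n hn] with k hk S Q hc
      rw [← map_sub]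
      exact (norm_chainSum_le _ hc).trans hk
    · refine le_of_tendsto ((ha s).sub_const _).norm ?_
      filter_upwards [hN' n hn] with k hk
      refine le_trans ?_ hk
      simpa using norm_seq_le hnorm (u k - u n) s
  have ha0 : Tendsto a atTop (𝓝 0) := by
    refine Metric.tendsto_atTop.2 fun ε hε => ?_
    obtain ⟨N, hN⟩ := hdiff (ε / 2) (half_pos hε)
    obtain ⟨K, hK⟩ := Metric.tendsto_atTop.1 (tendsto_seq (u N)) (ε / 2) (half_pos hε)
    refine ⟨K, fun s hs => ?_⟩
    have h1 := (hN N le_rfl).2 s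
    have h2 := hK s hs
    rw [dist_zero_right] at h2 ⊢
    calc ‖a s‖ = ‖(a s - seq h (u N) s) + seq h (u N) s‖ := by rw [sub_add_cancel]
      _ ≤ _ := norm_add_le _ _
      _ < ε := by linarith
  obtain ⟨N, hN⟩ := hdiff 1 one_pos
  obtain ⟨x, hx, -⟩ := exists_seq_eq (h := h) (M := 1 + ‖u N‖) ha0 (fun S Q hc => by
    have h1 := (hN N le_rfl).1 hc
    have h2 := norm_chainSum_le (u N) hc
    rw [← sub_add_cancel a (seq h (u N)), chainSum_add]
    exact (norm_add_le _ _).trans (add_le_add h1 h2))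
  refine ⟨x, Metric.tendsto_atTop.2 fun ε hε => ?_⟩
  obtain ⟨N, hN⟩ := hdiff (ε / 2) (half_pos hε)
  refine ⟨N, fun n hn => ?_⟩
  rw [dist_comm, dist_eq_norm]
  refine lt_of_le_of_lt (norm_le_of_chainBound (M := ε / 2) ?_) (half_lt_self hε)
  rw [map_sub, hx]
  exact (hN n hn).1

/-! ### Coordinates and truncations -/

variable (h) in
/-- The coordinate functional `x ↦ x s`. -/
noncomputable def coordCLM (s : ℕ) : StrongDual 𝕜 (JamesSpace h) :=
  ((LinearMap.proj s).comp (seq h)).mkContinuous ‖h s‖⁻¹ fun x => by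
    have h2 : 0 < ‖h s‖ := norm_pos_iff.2 (basis_ne_zero h s)
    rw [inv_mul_eq_div, le_div_iff₀ h2]
    exact coord_le_norm x s

@[simp]
theorem coordCLM_apply (s : ℕ) (x : JamesSpace h) : coordCLM h s x = seq h x s := rfl

theorem seq_unitVec (i : ℕ) : seq h (unitVec h i) = Pi.single i 1 := rfl

theorem seq_sum_unitVec (F : Finset ℕ) (i : ℕ) :
    seq h (∑ s ∈ F, unitVec h s) i = if i ∈ F then 1 else 0 := by
  rw [map_sum, Finset.sum_apply]
  simp [seq_unitVec, Pi.single_apply]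

variable (h) in
/-- Truncation of a sequence to its first `n` terms. -/
noncomputable def trunc (n : ℕ) : JamesSpace h →L[𝕜] JamesSpace h :=
  ∑ i ∈ Finset.range n, (coordCLM h i).smulRight (unitVec h i)

theorem trunc_apply (n : ℕ) (x : JamesSpace h) :
    trunc h n x = ∑ i ∈ Finset.range n, seq h x i • unitVec h i := by
  simp [trunc]

theorem seq_trunc (n : ℕ) (x : JamesSpace h) (i : ℕ) :
    seq h (trunc h n x) i = if i < n then seq h x i else 0 := by
  rw [trunc_apply, map_sum, Finset.sum_apply]
  simp [seq_unitVec, Pi.single_apply]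

theorem IsChainOn.card_crossing_le_one {S : Finset ℕ} {Q : ℕ → ℕ} (hc : IsChainOn S Q) (n : ℕ) :
    (S.filter fun p => p < n ∧ n ≤ Q p).card ≤ 1 := by
  refine Finset.card_le_one.2 fun p hp p' hp' => ?_
  simp only [Finset.mem_filter] at hp hp'
  by_contra hne
  rcases Nat.lt_or_gt_of_ne hne with hlt | hlt
  · have := hc.next p hp.1 p' hp'.1 hlt; omega
  · have := hc.next p' hp'.1 p hp.1 hlt; omega

theorem norm_sum_le_of_card_le_one {F : Finset ℕ} (hF : F.card ≤ 1) {f : ℕ → E} {M : ℝ}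
    (hM : 0 ≤ M) (hf : ∀ p ∈ F, ‖f p‖ ≤ M) : ‖∑ p ∈ F, f p‖ ≤ M := by
  rcases Finset.card_le_one_iff_subset_singleton.1 hF with ⟨p, hp⟩
  rcases Finset.subset_singleton_iff.1 hp with rfl | rfl
  · simpa using hM
  · simpa using hf p (by simp)

theorem norm_sum_range_unitVec_le (hnorm : ∀ j, ‖h j‖ = 1) (n : ℕ) :
    ‖∑ s ∈ Finset.range n, unitVec h s‖ ≤ 1 := by
  refine norm_le_of_chainBound fun S Q hc => ?_
  have : chainSum h (seq h (∑ s ∈ Finset.range n, unitVec h s)) S Q =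
      ∑ p ∈ S.filter (fun p => p < n ∧ n ≤ Q p), h p := by
    rw [chainSum, Finset.sum_filter]
    refine Finset.sum_congr rfl fun p hp => ?_
    have := hc.lt p hp
    simp only [seq_sum_unitVec, Finset.mem_range]
    split_ifs <;> first | omega | simp
  rw [this]
  exact norm_sum_le_of_card_le_one (hc.card_crossing_le_one n) zero_le_one fun p _ => (hnorm p).le

theorem norm_sum_Ico_unitVec_le (hnorm : ∀ j, ‖h j‖ = 1) (a b : ℕ) :
    ‖∑ s ∈ Finset.Ico a b, unitVec h s‖ ≤ 2 := by
  rcases le_total a b with hab | hab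
  · rw [Finset.sum_Ico_eq_sub _ hab]
    refine (norm_sub_le _ _).trans ?_
    linarith [norm_sum_range_unitVec_le hnorm a, norm_sum_range_unitVec_le hnorm b]
  · simp [Finset.Ico_eq_empty_of_le hab]

theorem norm_trunc_apply_le (hnorm : ∀ j, ‖h j‖ = 1) (n : ℕ) (x : JamesSpace h) :
    ‖trunc h n x‖ ≤ 2 * ‖x‖ := by
  refine norm_le_of_chainBound fun S Q hc => ?_
  have : chainSum h (seq h (trunc h n x)) S Q =
      chainSum h (seq h x) (S.filter fun p => Q p < n) Q +
      ∑ p ∈ S.filter (fun p => p < n ∧ n ≤ Q p), seq h x p • h p := by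
    rw [chainSum, chainSum, Finset.sum_filter, Finset.sum_filter, ← Finset.sum_add_distrib]
    refine Finset.sum_congr rfl fun p hp => ?_
    have := hc.lt p hp
    simp only [seq_trunc]
    split_ifs <;> first | omega | simp
  rw [this, two_mul]
  refine (norm_add_le _ _).trans (add_le_add (norm_chainSum_le x
    (hc.mono (Finset.filter_subset _ _))) (norm_sum_le_of_card_le_one
    (hc.card_crossing_le_one n) (norm_nonneg _) fun p _ => ?_))
  rw [norm_smul, hnorm, mul_one]
  exact norm_seq_le hnorm x p

/-- The unit vectors form a basis of `J(h_j)`. -/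
theorem tendsto_trunc (hE : IsReflexiveSpace 𝕜 E) (hnorm : ∀ j, ‖h j‖ = 1) (x : JamesSpace h) :
    Tendsto (fun n => trunc h n x) atTop (𝓝 x) := by
  refine Metric.tendsto_atTop.2 fun ε hε => ?_
  obtain ⟨n₁, hn₁⟩ := (norm_chainSum_le x).exists_tail_le hE (show 0 < ε / 3 by positivity)
  obtain ⟨n₂, hn₂⟩ := Metric.tendsto_atTop.1 (tendsto_seq x) (ε / 3) (by positivity)
  refine ⟨max n₁ n₂, fun n hn => ?_⟩
  rw [dist_comm, dist_eq_norm]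
  refine lt_of_le_of_lt (norm_le_of_chainBound (M := ε / 3 + ε / 3) fun S Q hc => ?_) (by linarith)
  have : chainSum h (seq h (x - trunc h n x)) S Q =
      chainSum h (seq h x) (S.filter fun p => n ≤ p) Q +
      ∑ p ∈ S.filter (fun p => p < n ∧ n ≤ Q p), -seq h x (Q p) • h p := by
    rw [chainSum, chainSum, Finset.sum_filter, Finset.sum_filter, ← Finset.sum_add_distrib]
    refine Finset.sum_congr rfl fun p hp => ?_
    have := hc.lt p hp
    simp only [map_sub, Pi.sub_apply, seq_trunc]
    split_ifs <;> first | omega | simp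
  rw [this]
  refine (norm_add_le _ _).trans (add_le_add ?_ (norm_sum_le_of_card_le_one
    (hc.card_crossing_le_one n) (by positivity) fun p hp => ?_))
  · refine hn₁ _ _ (hc.mono (Finset.filter_subset _ _)) fun p hp => ?_
    exact (le_max_left _ _).trans (hn.trans (Finset.mem_filter.1 hp).2)
  · rw [norm_smul, hnorm, mul_one, norm_neg]
    have := hn₂ (Q p) ((le_max_right _ _).trans (hn.trans (Finset.mem_filter.1 hp).2.2))
    rw [dist_zero_right] at this
    exact this.le

end JamesSpace

namespace JamesSpace

variable {𝕜 E : Type*} [RCLike 𝕜] [NormedAddCommGroup E] [NormedSpace 𝕜 E]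
  {h : SchauderBasis 𝕜 E}

/-! ### The unit vector basis is shrinking -/

/-- The image of the finite sequence `a 0, …, a (m - 1)` under the infinite matrix `A`, as a
combination of the basis vectors `h 0, …, h (m - 1)`. -/
noncomputable def matrixSum (h : ℕ → E) (A : ℕ → ℕ → 𝕜) (a : ℕ → 𝕜) (m : ℕ) : E :=
  ∑ p ∈ Finset.range m, (∑ i ∈ Finset.range m, A p i * a i) • h p

/-- The matrix sending a sequence to its differences along a chain. -/
noncomputable def chainMatrix (𝕜 : Type*) [RCLike 𝕜] (S : Finset ℕ) (Q : ℕ → ℕ) (p i : ℕ) : 𝕜 :=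
  if p ∈ S then (if i = p then 1 else 0) - (if i = Q p then 1 else 0) else 0

theorem IsChainOn.matrixSum_chainMatrix {S : Finset ℕ} {Q : ℕ → ℕ} (hc : IsChainOn S Q)
    (h : ℕ → E) {a : ℕ → 𝕜} {m : ℕ} (ha : ∀ i, m ≤ i → a i = 0) :
    matrixSum h (chainMatrix 𝕜 S Q) a m = chainSum h a S Q := by
  have h1 : chainSum h a S Q =
      ∑ p ∈ Finset.range m, if p ∈ S then (a p - a (Q p)) • h p else 0 := by
    rw [← Finset.sum_filter, chainSum]
    refine (Finset.sum_subset (fun p hp => (Finset.mem_filter.1 hp).2) fun p hp hp' => ?_).symm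
    simp only [Finset.mem_filter, Finset.mem_range, not_and_or, not_lt] at hp'
    have hmp : m ≤ p := hp'.resolve_right fun hn => hn hp
    rw [ha p hmp, ha (Q p) (hmp.trans (hc.lt p hp).le), sub_zero, zero_smul]
  rw [h1, matrixSum]
  refine Finset.sum_congr rfl fun p hp => ?_
  by_cases hpS : p ∈ S
  · have hq : (if Q p < m then a (Q p) else 0) = a (Q p) := by
      split_ifs with hlt
      exacts [rfl, (ha _ (not_lt.1 hlt)).symm]
    simp only [chainMatrix, hpS, if_true, sub_mul, ite_mul, one_mul, zero_mul,
      Finset.sum_sub_distrib, Finset.sum_ite_eq', Finset.mem_range, Finset.mem_range.1 hp, hq]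
  · simp [chainMatrix, hpS]

theorem sum_norm_chainMatrix_le (S : Finset ℕ) (Q : ℕ → ℕ) (p N : ℕ) :
    ∑ i ∈ Finset.range N, ‖chainMatrix 𝕜 S Q p i‖ ≤ 2 := by
  have hle : ∀ i, ‖chainMatrix 𝕜 S Q p i‖ ≤
      (if i = p then 1 else 0) + (if i = Q p then 1 else 0) := by
    intro i
    unfold chainMatrix
    split_ifs <;> simp
  refine (Finset.sum_le_sum fun i _ => hle i).trans ?_
  rw [Finset.sum_add_distrib, Finset.sum_ite_eq', Finset.sum_ite_eq']
  split_ifs <;> norm_num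

/-- Matrices with rows of `ℓ¹`-norm at most two that map the given finite sequences to vectors of
norm at most `C`. -/
def boundedMatrices (h : ℕ → E) (u : ℕ → ℕ → 𝕜) (m : ℕ → ℕ) (C : ℝ) : Set (ℕ → ℕ → 𝕜) :=
  {A | (∀ p N, ∑ i ∈ Finset.range N, ‖A p i‖ ≤ 2) ∧ ∀ n, ‖matrixSum h A (u n) (m n)‖ ≤ C}

theorem isCompact_boundedMatrices (h : ℕ → E) (u : ℕ → ℕ → 𝕜) (m : ℕ → ℕ) (C : ℝ) :
    IsCompact (boundedMatrices h u m C) := by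
  have hK : IsCompact (Set.univ.pi fun _ : ℕ => Set.univ.pi fun _ : ℕ =>
      Metric.closedBall (0 : 𝕜) 2) :=
    isCompact_univ_pi fun _ => isCompact_univ_pi fun _ => isCompact_closedBall _ _
  have hc : ∀ p i, Continuous fun A : ℕ → ℕ → 𝕜 => A p i := fun p i => continuous_apply_apply p i
  refine hK.of_isClosed_subset ?_ fun A hA p _ i _ => ?_
  · refine IsClosed.inter (s₁ := {A | ∀ p N, ∑ i ∈ Finset.range N, ‖A p i‖ ≤ 2})
      (s₂ := {A | ∀ n, ‖matrixSum h A (u n) (m n)‖ ≤ C}) ?_ ?_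
    · simp only [Set.ofPred_forall]
      exact isClosed_iInter fun p => isClosed_iInter fun N => isClosed_le (by fun_prop) (by fun_prop)
    · simp only [Set.ofPred_forall]
      refine isClosed_iInter fun n => isClosed_le ?_ (by fun_prop)
      unfold matrixSum
      fun_prop
  · have h1 := hA.1 p (i + 1)
    rw [Finset.sum_range_succ] at h1
    rw [mem_closedBall_zero_iff]
    have : 0 ≤ ∑ j ∈ Finset.range i, ‖A p j‖ := Finset.sum_nonneg fun _ _ => norm_nonneg _
    linarith

/-- Bounded blocks in `J(h_j)` have convex combinations that are small in norm. -/
theorem exists_convexCombination_norm_le (hE : IsReflexiveSpace 𝕜 E) (hnorm : ∀ j, ‖h j‖ = 1)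
    {u : ℕ → JamesSpace h} {m : ℕ → ℕ} {C : ℝ} (hC : ∀ n, ‖u n‖ ≤ C)
    (hu : ∀ n i, i < n ∨ m n ≤ i → seq h (u n) i = 0) {η : ℝ} (hη : 0 < η) :
    ∃ (F : Finset ℕ) (w : ℕ → ℝ), (∀ n, 0 ≤ w n) ∧ ∑ n ∈ F, w n = 1 ∧
      ‖∑ n ∈ F, (w n : 𝕜) • u n‖ ≤ η := by
  set K₁ := boundedMatrices h (fun n => seq h (u n)) m C with hK₁
  set K₂ : Set (WeakDual 𝕜 E) := WeakDual.toStrongDual ⁻¹' Metric.closedBall 0 1 with hK₂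
  have hK : IsCompact (K₁ ×ˢ K₂) :=
    (isCompact_boundedMatrices _ _ _ _).prod (WeakDual.isCompact_closedBall 0 1)
  have : CompactSpace ↥(K₁ ×ˢ K₂) := isCompact_iff_compactSpace.1 hK
  let g : ℕ → ↥(K₁ ×ˢ K₂) → ℝ := fun n P => ‖P.1.2 (matrixSum h P.1.1 (seq h (u n)) (m n))‖
  have hg : ∀ n, Continuous (g n) := fun n => by
    have h1 : ∀ p i, Continuous fun P : ↥(K₁ ×ˢ K₂) => P.1.1 p i := fun p i =>
      (continuous_apply_apply p i).comp (continuous_fst.comp continuous_subtype_val)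
    have h2 : ∀ p, Continuous fun P : ↥(K₁ ×ˢ K₂) => P.1.2 (h p) := fun p =>
      (WeakDual.eval_continuous (h p)).comp (continuous_snd.comp continuous_subtype_val)
    simp only [g, matrixSum, map_sum, map_smul, smul_eq_mul]
    fun_prop
  have hunit : ∀ (y : StrongDual 𝕜 E) (v : E), ‖y‖ ≤ 1 → ‖y v‖ ≤ ‖v‖ := fun y v hy =>
    (y.le_opNorm v).trans (mul_le_of_le_one_left (norm_nonneg _) hy)
  have hgC : ∀ n P, g n P ≤ C := fun n P =>
    (hunit (WeakDual.toStrongDual P.1.2) _ (by simpa [hK₂] using P.2.2)).trans (P.2.1.2 n)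
  have hlim : ∀ P, Tendsto (fun n => g n P) atTop (𝓝 0) := by
    intro P
    have hrow : ∀ p, Summable fun i => ‖P.1.1 p i‖ := fun p =>
      summable_of_sum_range_le (fun _ => norm_nonneg _) (P.2.1.1 p)
    refine tendsto_zero_iff_norm_tendsto_zero.1 (hE.tendsto_dual_of_coord h
      (v := fun n => matrixSum h P.1.1 (seq h (u n)) (m n)) P.2.1.2 (fun j => ?_)
      (WeakDual.toStrongDual P.1.2))
    have htail : Tendsto (fun n => (∑' i, ‖P.1.1 j (i + n)‖) * C) atTop (𝓝 0) := by
      simpa using (tendsto_sum_nat_add fun i => ‖P.1.1 j i‖).mul_const C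
    refine squeeze_zero_norm (fun n => ?_) htail
    have hC0 : 0 ≤ C := (norm_nonneg _).trans (hC 0)
    have htsum : 0 ≤ ∑' i, ‖P.1.1 j (i + n)‖ := tsum_nonneg fun _ => norm_nonneg _
    rw [matrixSum, SchauderBasis.coord_sum_range]
    split_ifs
    · have h1 : ∑ i ∈ Finset.range (m n), P.1.1 j i * seq h (u n) i =
          ∑ i ∈ Finset.range (m n - n), P.1.1 j (i + n) * seq h (u n) (i + n) := by
        rcases le_total n (m n) with hle | hle
        · rw [← Finset.sum_range_add_sum_Ico _ hle, Finset.sum_eq_zero, zero_add,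
            Finset.sum_Ico_eq_sum_range]
          · simp only [add_comm]
          · intro i hi
            rw [hu n i (Or.inl (Finset.mem_range.1 hi)), mul_zero]
        · rw [Nat.sub_eq_zero_of_le hle, Finset.range_zero, Finset.sum_empty]
          refine Finset.sum_eq_zero fun i hi => ?_
          rw [hu n i (Or.inl ((Finset.mem_range.1 hi).trans_le hle)), mul_zero]
      rw [h1]
      calc ‖∑ i ∈ Finset.range (m n - n), P.1.1 j (i + n) * seq h (u n) (i + n)‖
          ≤ ∑ i ∈ Finset.range (m n - n), ‖P.1.1 j (i + n)‖ * C := by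
            refine norm_sum_le_of_le _ fun i _ => ?_
            rw [norm_mul]
            exact mul_le_mul_of_nonneg_left ((norm_seq_le hnorm _ _).trans (hC n)) (norm_nonneg _)
        _ = (∑ i ∈ Finset.range (m n - n), ‖P.1.1 j (i + n)‖) * C := (Finset.sum_mul _ _ _).symm
        _ ≤ _ := mul_le_mul_of_nonneg_right (((summable_nat_add_iff n).2 (hrow j)).sum_le_tsum _
            fun _ _ => norm_nonneg _) hC0
    · rw [norm_zero]
      positivity
  obtain ⟨b, -, w, hw0, hw1, hw⟩ :=
    exists_convexCombination_le hg (fun _ _ => norm_nonneg _) hgC hlim 0 hη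
  refine ⟨Finset.Ico 0 b, w, hw0, hw1, norm_le_of_chainBound fun S Q hc => ?_⟩
  obtain ⟨y, hy1, hy⟩ := exists_dual_vector'' 𝕜
    (chainSum h (seq h (∑ n ∈ Finset.Ico 0 b, (w n : 𝕜) • u n)) S Q)
  have hmat : ∀ n, matrixSum h (chainMatrix 𝕜 S Q) (seq h (u n)) (m n) =
      chainSum h (seq h (u n)) S Q := fun n =>
    hc.matrixSum_chainMatrix h fun i hi => hu n i (Or.inr hi)
  have hmem : (chainMatrix 𝕜 S Q, StrongDual.toWeakDual y) ∈ K₁ ×ˢ K₂ := by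
    refine ⟨⟨sum_norm_chainMatrix_le S Q, fun n => ?_⟩, by simpa [hK₂] using hy1⟩
    rw [hmat]
    exact (norm_chainSum_le (u n) hc).trans (hC n)
  have hlin : chainSum h (seq h (∑ n ∈ Finset.Ico 0 b, (w n : 𝕜) • u n)) S Q =
      ∑ n ∈ Finset.Ico 0 b, (w n : 𝕜) • chainSum h (seq h (u n)) S Q := by
    let L : (ℕ → 𝕜) →ₗ[𝕜] E :=
      { toFun := fun a => chainSum h a S Q
        map_add' := fun a b => chainSum_add _ a b S Q
        map_smul' := fun c a => chainSum_smul _ c a S Q }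
    change L (seq h _) = ∑ n ∈ Finset.Ico 0 b, (w n : 𝕜) • L (seq h (u n))
    simp only [map_sum, map_smul]
  have hnrm : ‖y (chainSum h (seq h (∑ n ∈ Finset.Ico 0 b, (w n : 𝕜) • u n)) S Q)‖ =
      ‖chainSum h (seq h (∑ n ∈ Finset.Ico 0 b, (w n : 𝕜) • u n)) S Q‖ := by
    rw [hy]; simp
  rw [← hnrm, hlin, map_sum]
  refine (norm_sum_le_of_le _ fun n _ => ?_).trans (hw ⟨_, hmem⟩)
  rw [map_smul, norm_smul, RCLike.norm_ofReal, abs_of_nonneg (hw0 n), ← hmat]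
  exact le_rfl

/-- The unit vector basis of `J(h_j)` is shrinking. -/
theorem exists_norm_apply_sub_trunc_le (hE : IsReflexiveSpace 𝕜 E) (hnorm : ∀ j, ‖h j‖ = 1)
    (f : StrongDual 𝕜 (JamesSpace h)) {ε : ℝ} (hε : 0 < ε) :
    ∃ n, ∀ x, ‖f (x - trunc h n x)‖ ≤ ε * ‖x‖ := by
  by_contra! hcon
  have hblock : ∀ n, ∃ (u : JamesSpace h) (m : ℕ), ‖u‖ ≤ 4 ∧ ε < RCLike.re (f u) ∧
      ∀ i, i < n ∨ m ≤ i → seq h u i = 0 := by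
    intro n
    obtain ⟨x, hx⟩ := hcon n
    have hx0 : 0 < ‖x‖ := by
      rw [norm_pos_iff]
      rintro rfl
      simp at hx
    have hlim : Tendsto (fun m => ‖f (trunc h m x - trunc h n x)‖) atTop
        (𝓝 ‖f (x - trunc h n x)‖) :=
      ((f.continuous.tendsto _).comp ((tendsto_trunc hE hnorm x).sub_const _)).norm
    obtain ⟨m, hm, hnm⟩ := ((hlim.eventually_const_lt hx).and (eventually_ge_atTop n)).exists
    obtain ⟨c, hc1, hc⟩ := RCLike.exists_norm_eq_mul_self (f (trunc h m x - trunc h n x))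
    refine ⟨((‖x‖⁻¹ : ℝ) : 𝕜) • c • (trunc h m x - trunc h n x), m, ?_, ?_, ?_⟩
    · rw [norm_smul, norm_smul, hc1, one_mul, RCLike.norm_ofReal, abs_of_pos (inv_pos.2 hx0),
        inv_mul_le_iff₀ hx0]
      refine (norm_sub_le _ _).trans ?_
      linarith [norm_trunc_apply_le hnorm m x, norm_trunc_apply_le hnorm n x]
    · rw [map_smul f, map_smul f, smul_eq_mul, smul_eq_mul, ← hc, ← RCLike.ofReal_mul,
        RCLike.ofReal_re, inv_mul_eq_div, lt_div_iff₀ hx0]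
      exact hm
    · intro i hi
      simp only [map_smul, map_sub, Pi.smul_apply, Pi.sub_apply, seq_trunc]
      split_ifs <;> first | omega | simp
  choose u m hu4 huf hu using hblock
  obtain ⟨F, w, hw0, hw1, hw⟩ := exists_convexCombination_norm_le hE hnorm hu4 hu
    (show 0 < ε / (2 * (‖f‖ + 1)) by positivity)
  have h1 : ε ≤ RCLike.re (f (∑ n ∈ F, (w n : 𝕜) • u n)) := by
    simp only [map_sum, map_smul, smul_eq_mul, RCLike.re_ofReal_mul]
    calc ε = ∑ n ∈ F, w n * ε := by rw [← Finset.sum_mul, hw1, one_mul]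
      _ ≤ _ := Finset.sum_le_sum fun n _ => mul_le_mul_of_nonneg_left (huf n).le (hw0 n)
  have h2 : ‖f (∑ n ∈ F, (w n : 𝕜) • u n)‖ ≤ ‖f‖ * (ε / (2 * (‖f‖ + 1))) :=
    (f.le_opNorm _).trans (mul_le_mul_of_nonneg_left hw (norm_nonneg _))
  have h3 : ‖f‖ * (ε / (2 * (‖f‖ + 1))) ≤ ε / 2 := by
    rw [mul_div_assoc', div_le_div_iff₀ (by positivity) two_pos]
    nlinarith [norm_nonneg f]
  linarith [RCLike.re_le_norm (f (∑ n ∈ F, (w n : 𝕜) • u n))]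

/-! ### The bidual -/

/-- Functionals on the dual of `J(h_j)` are determined by their values at the coordinates. -/
theorem bidual_eq_zero (hE : IsReflexiveSpace 𝕜 E) (hnorm : ∀ j, ‖h j‖ = 1)
    {φ : StrongDual 𝕜 (StrongDual 𝕜 (JamesSpace h))} (hφ : ∀ i, φ (coordCLM h i) = 0) : φ = 0 := by
  ext f
  rw [zero_apply, ← norm_le_zero_iff]
  refine le_of_forall_pos_le_add fun ε hε => ?_
  obtain ⟨n, hn⟩ := exists_norm_apply_sub_trunc_le hE hnorm f
    (show 0 < ε / (‖φ‖ + 1) by positivity)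
  have h1 : φ (f.comp (trunc h n)) = 0 := by
    have : f.comp (trunc h n) = ∑ i ∈ Finset.range n, f (unitVec h i) • coordCLM h i := by
      ext x
      simp [trunc_apply, mul_comm]
    rw [this, map_sum]
    simp [hφ]
  have h2 : ‖f - f.comp (trunc h n)‖ ≤ ε / (‖φ‖ + 1) :=
    ContinuousLinearMap.opNorm_le_bound _ (by positivity) fun x => by
      simpa using hn x
  calc ‖φ f‖ = ‖φ (f - f.comp (trunc h n))‖ := by rw [map_sub, h1, sub_zero]
    _ ≤ ‖φ‖ * (ε / (‖φ‖ + 1)) :=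
      (φ.le_opNorm _).trans (mul_le_mul_of_nonneg_left h2 (norm_nonneg _))
    _ ≤ 0 + ε := by
      rw [zero_add, mul_div_assoc', div_le_iff₀ (by positivity)]
      nlinarith [norm_nonneg φ]

theorem bidual_ext (hE : IsReflexiveSpace 𝕜 E) (hnorm : ∀ j, ‖h j‖ = 1)
    {φ ψ : StrongDual 𝕜 (StrongDual 𝕜 (JamesSpace h))}
    (hφ : ∀ i, φ (coordCLM h i) = ψ (coordCLM h i)) : φ = ψ :=
  sub_eq_zero.1 (bidual_eq_zero hE hnorm fun i => by simp [hφ])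

theorem bidual_chainBound (φ : StrongDual 𝕜 (StrongDual 𝕜 (JamesSpace h))) :
    ChainBound h (fun i => φ (coordCLM h i)) ‖φ‖ := by
  intro S Q hc
  refine NormedSpace.norm_le_dual_bound 𝕜 _ φ.opNorm_nonneg fun g => ?_
  let F : StrongDual 𝕜 (JamesSpace h) := ∑ p ∈ S, g (h p) • (coordCLM h p - coordCLM h (Q p))
  have hF : ∀ x, F x = g (chainSum h (seq h x) S Q) := fun x => by
    simp [F, chainSum, mul_comm]
  have h1 : g (chainSum h (fun i => φ (coordCLM h i)) S Q) = φ F := by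
    simp [F, chainSum, mul_comm]
  rw [h1]
  refine (φ.le_opNorm F).trans (mul_le_mul_of_nonneg_left ?_ φ.opNorm_nonneg)
  refine ContinuousLinearMap.opNorm_le_bound _ (norm_nonneg _) fun x => ?_
  rw [hF]
  exact (g.le_opNorm _).trans
    (mul_le_mul_of_nonneg_left (norm_chainSum_le x hc) (norm_nonneg _))

/-- The coordinates of an element of the bidual differ from a sequence in `J(h_j)` by a constant. -/
theorem bidual_exists_coord_eq (hE : IsReflexiveSpace 𝕜 E) (hnorm : ∀ j, ‖h j‖ = 1)
    (φ : StrongDual 𝕜 (StrongDual 𝕜 (JamesSpace h))) :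
    ∃ (x : JamesSpace h) (c : 𝕜), ∀ i, φ (coordCLM h i) = seq h x i + c := by
  obtain ⟨c, hc⟩ := (bidual_chainBound φ).exists_tendsto hE hnorm
  obtain ⟨x, hx, -⟩ := exists_seq_eq (h := h) (a := fun i => φ (coordCLM h i) - c) (M := ‖φ‖)
    (by simpa using hc.sub_const c) (fun S Q hS => by
      have := bidual_chainBound φ hS
      simpa [chainSum] using this)
  exact ⟨x, c, fun i => by rw [hx, sub_add_cancel]⟩

theorem isQuasiReflexiveOfOrderOne (hE : IsReflexiveSpace 𝕜 E) (hnorm : ∀ j, ‖h j‖ = 1) :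
    IsQuasiReflexiveOfOrderOne 𝕜 (JamesSpace h) := by
  obtain ⟨ξ, -, hξ⟩ := exists_dual_mapClusterPt (l := atTop) (fun n : ℕ =>
    NormedSpace.inclusionInDoubleDual 𝕜 (JamesSpace h) (∑ s ∈ Finset.range n, unitVec h s))
    (M := 1) fun n => (NormedSpace.double_dual_bound 𝕜 _ _).trans
      (norm_sum_range_unitVec_le hnorm n)
  have hξ1 : ∀ i, ξ (coordCLM h i) = 1 := fun i => by
    refine (hξ (coordCLM h i)).eq_of_tendsto (tendsto_const_nhds.congr' ?_)
    filter_upwards [eventually_gt_atTop i] with n hn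
    rw [NormedSpace.dual_def, coordCLM_apply, seq_sum_unitVec, if_pos (Finset.mem_range.2 hn)]
  refine ⟨ξ, ?_, fun φ => ?_⟩
  · rintro ⟨x, rfl⟩
    refine one_ne_zero (α := 𝕜) (tendsto_nhds_unique ?_ (tendsto_seq x))
    exact tendsto_const_nhds.congr fun i => (hξ1 i).symm
  · obtain ⟨x, c, hx⟩ := bidual_exists_coord_eq hE hnorm φ
    refine ⟨x, c, bidual_ext hE hnorm fun i => ?_⟩
    simp [hx, hξ1, NormedSpace.dual_def]

end JamesSpace

namespace JamesSpace

variable {𝕜 E : Type*} [RCLike 𝕜] [NormedAddCommGroup E] [NormedSpace 𝕜 E]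
  {h : SchauderBasis 𝕜 E}

/-! ### Combinatorics of chains and step sequences -/

theorem sum_comp_orderEmbOfFin (S : Finset ℕ) {M : Type*} [AddCommMonoid M] (f : ℕ → M) :
    ∑ i : Fin S.card, f (S.orderEmbOfFin rfl i) = ∑ p ∈ S, f p := by
  conv_rhs => rw [← S.image_orderEmbOfFin_univ rfl]
  rw [Finset.sum_image (S.orderEmbOfFin rfl).injective.injOn]

theorem norm_sum_pairs_le (x : JamesSpace h) {S : Finset ℕ} {P R : ℕ → ℕ}
    (hPR : ∀ p ∈ S, P p < R p) (hRP : ∀ p ∈ S, ∀ p' ∈ S, p < p' → R p < P p') :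
    ‖∑ p ∈ S, (seq h x (P p) - seq h x (R p)) • h (P p)‖ ≤ ‖x‖ := by
  rw [← sum_comp_orderEmbOfFin S fun p => (seq h x (P p) - seq h x (R p)) • h (P p)]
  exact pairSum_le_norm x (p := fun i => P (S.orderEmbOfFin rfl i))
    (q := fun i => R (S.orderEmbOfFin rfl i))
    ⟨fun i => hPR _ (S.orderEmbOfFin_mem rfl i), fun i j hij =>
      hRP _ (S.orderEmbOfFin_mem rfl i) _ (S.orderEmbOfFin_mem rfl j)
        ((S.orderEmbOfFin rfl).strictMono hij)⟩

/-- Right dominance for sums indexed by a finite set. -/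
theorem _root_.IsRightDominant.norm_sum_le (hrd : IsRightDominant h) {S : Finset ℕ} {σ : ℕ → ℕ}
    (hσ : ∀ p ∈ S, p ≤ σ p) (hσ' : ∀ p ∈ S, ∀ p' ∈ S, p < p' → σ p < p') (a : ℕ → 𝕜) :
    ‖∑ p ∈ S, a p • h p‖ ≤ 2 * ‖∑ p ∈ S, a p • h (σ p)‖ := by
  let e := S.orderEmbOfFin rfl
  have he : ∀ i, e i ∈ S := S.orderEmbOfFin_mem rfl
  have key := hrd (fun i => if hi : i < S.card then e ⟨i, hi⟩ else S.sup σ + i)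
    (fun i => if hi : i < S.card then σ (e ⟨i, hi⟩) else S.sup σ + i)
    (fun i => by
      split_ifs
      exacts [hσ _ (he _), le_rfl])
    (fun i => by
      split_ifs with h1 h2
      · exact hσ' _ (he _) _ (he _) (e.strictMono (Nat.lt_succ_self i))
      · have := Finset.le_sup (f := σ) (he ⟨i, h1⟩)
        omega
      · omega
      · omega)
    S.card (fun i => if hi : i < S.card then a (e ⟨i, hi⟩) else 0)
  simp only [Finset.sum_range, Fin.is_lt, dif_pos, Fin.eta] at key
  rw [sum_comp_orderEmbOfFin S fun p => a p • h p,
    sum_comp_orderEmbOfFin S fun p => a p • h (σ p)] at key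
  exact key

/-- A finite set splits into two sets such that any two distinct elements of one of them are
separated by an element of the given set. -/
theorem exists_split (S : Finset ℕ) :
    ∃ S₀ ⊆ S, ∃ S₁ ⊆ S, (∀ f : ℕ → E, ∑ p ∈ S, f p = ∑ p ∈ S₀, f p + ∑ p ∈ S₁, f p) ∧
      (∀ p ∈ S₀, ∀ p' ∈ S₀, p < p' → ∃ r ∈ S, p < r ∧ r < p') ∧
      ∀ p ∈ S₁, ∀ p' ∈ S₁, p < p' → ∃ r ∈ S, p < r ∧ r < p' := by
  let rank : ℕ → ℕ := fun p => (S.filter (· < p)).card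
  have hrank : ∀ p ∈ S, ∀ p', p < p' → (∀ r ∈ S, p < r → p' ≤ r) → rank p' = rank p + 1 := by
    intro p hp p' hlt hno
    have : S.filter (· < p') = insert p (S.filter (· < p)) := by
      ext r
      simp only [Finset.mem_filter, Finset.mem_insert]
      constructor
      · rintro ⟨hr, hrp⟩
        by_contra! hcon
        have h1 := hcon.2 hr
        have := hno r hr (lt_of_le_of_ne h1 (Ne.symm hcon.1))
        omega
      · rintro (rfl | ⟨hr, hrp⟩)
        exacts [⟨hp, hlt⟩, ⟨hr, hrp.trans hlt⟩]
    simp only [rank]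
    rw [this, Finset.card_insert_of_notMem (by simp)]
  have hsep : ∀ p ∈ S, ∀ p', p < p' → (Even (rank p) ↔ Even (rank p')) →
      ∃ r ∈ S, p < r ∧ r < p' := by
    intro p hp p' hlt hpar
    by_contra! hno
    rw [hrank p hp p' hlt hno, Nat.even_add_one] at hpar
    tauto
  refine ⟨S.filter fun p => Even (rank p), Finset.filter_subset _ _,
    S.filter fun p => ¬ Even (rank p), Finset.filter_subset _ _,
    fun f => (Finset.sum_filter_add_sum_filter_not _ _ _).symm, ?_, ?_⟩
  all_goals
    intro p hp p' hp' hlt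
    rw [Finset.mem_filter] at hp hp'
    exact hsep p hp.1 p' hlt (by tauto)

/-- The left endpoints of the intervals `{0}`, `[1, t 1)`, `[t 1, t 2)`, … -/
def shiftEnd (t : ℕ → ℕ) : ℕ → ℕ
  | 0 => 0
  | 1 => 1
  | j + 2 => t (j + 1)

theorem monotone_shiftEnd {t : ℕ → ℕ} (ht : StrictMono t) : Monotone (shiftEnd t) := by
  refine monotone_nat_of_le_succ fun j => ?_
  match j with
  | 0 => exact Nat.zero_le _
  | 1 => exact (Nat.zero_le _).trans_lt (ht zero_lt_one)
  | j + 2 => exact (ht (Nat.lt_succ_self (j + 1))).le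

theorem le_shiftEnd_succ {t : ℕ → ℕ} (ht : StrictMono t) (i : ℕ) : i ≤ shiftEnd t (i + 1) := by
  match i with
  | 0 => exact Nat.zero_le _
  | i + 1 => exact ht.le_apply

/-- The index of the interval between consecutive values of `shiftEnd t` that contains `i`. -/
def shiftIndex (t : ℕ → ℕ) (i : ℕ) : ℕ := Nat.findGreatest (fun j => shiftEnd t j ≤ i) (i + 1)

theorem shiftEnd_shiftIndex_le (t : ℕ → ℕ) (i : ℕ) : shiftEnd t (shiftIndex t i) ≤ i :=
  Nat.findGreatest_spec (P := fun j => shiftEnd t j ≤ i) (Nat.zero_le _) (Nat.zero_le _)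

theorem lt_shiftEnd_shiftIndex_succ {t : ℕ → ℕ} (ht : StrictMono t) (i : ℕ) :
    i < shiftEnd t (shiftIndex t i + 1) := by
  by_contra! hle
  have h1 : shiftIndex t i + 1 ≤ i + 1 := by
    by_contra! hlt
    have h2 := monotone_shiftEnd ht hlt.le
    have h3 := le_shiftEnd_succ ht (i + 1)
    have h4 := monotone_shiftEnd ht (Nat.succ_le_of_lt hlt)
    simp only [Nat.succ_eq_add_one] at h4
    omega
  have := Nat.le_findGreatest (P := fun j => shiftEnd t j ≤ i) h1 hle
  exact absurd this (by simp [shiftIndex])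

theorem shiftIndex_eq {t : ℕ → ℕ} (ht : StrictMono t) {i j : ℕ} (h1 : shiftEnd t j ≤ i)
    (h2 : i < shiftEnd t (j + 1)) : shiftIndex t i = j := by
  refine le_antisymm ?_ ?_
  · by_contra! hlt
    have := monotone_shiftEnd ht (Nat.succ_le_of_lt hlt)
    have := shiftEnd_shiftIndex_le t i
    simp only [Nat.succ_eq_add_one] at *
    omega
  · by_contra! hlt
    have := monotone_shiftEnd ht (Nat.succ_le_of_lt hlt)
    have := lt_shiftEnd_shiftIndex_succ ht i
    simp only [Nat.succ_eq_add_one] at *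
    omega

theorem monotone_shiftIndex {t : ℕ → ℕ} (ht : StrictMono t) : Monotone (shiftIndex t) := by
  intro i i' hi
  by_contra! hlt
  have h1 := monotone_shiftEnd ht (Nat.succ_le_of_lt hlt)
  have h2 := shiftEnd_shiftIndex_le t i
  have h3 := lt_shiftEnd_shiftIndex_succ ht i'
  simp only [Nat.succ_eq_add_one] at h1
  omega

theorem le_apply_shiftIndex {t : ℕ → ℕ} (ht : StrictMono t) (i : ℕ) : i ≤ t (shiftIndex t i) := by
  have := lt_shiftEnd_shiftIndex_succ ht i
  match hj : shiftIndex t i with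
  | 0 =>
    rw [hj] at this
    have : i < 1 := this
    omega
  | j + 1 =>
    rw [hj] at this
    exact this.le

theorem apply_le_of_shiftIndex {t : ℕ → ℕ} (ht : StrictMono t) {i j : ℕ}
    (hj : j + 2 ≤ shiftIndex t i) : t (j + 1) ≤ i :=
  (monotone_shiftEnd ht hj).trans (shiftEnd_shiftIndex_le t i)

/-- The step sequence `i ↦ x (s (shiftIndex t i))`, with `s j ∈ [t j, t (j + 1))`, satisfies the
chain estimates with constant `6`, and with constant `4` in the right dominant case. -/
theorem chainBound_step {t s : ℕ → ℕ} (ht : StrictMono t)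
    (hs : ∀ j, t j ≤ s j ∧ s j < t (j + 1)) (x : JamesSpace h) :
    ChainBound h (fun i => seq h x (s (shiftIndex t i))) (6 * ‖x‖) ∧
    (IsRightDominant h → ChainBound h (fun i => seq h x (s (shiftIndex t i))) (4 * ‖x‖)) := by
  set β := shiftIndex t with hβ
  have hβm : Monotone β := monotone_shiftIndex ht
  have hsm : StrictMono s := strictMono_nat_of_lt_succ fun j => (hs j).2.trans_le (hs (j + 1)).1
  have hle : ∀ p, p ≤ s (β p) := fun p => (le_apply_shiftIndex ht p).trans (hs _).1
  have hlt : ∀ j p, j + 2 ≤ β p → s j < p := fun j p hj =>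
    (hs j).2.trans_le (apply_le_of_shiftIndex ht hj)
  suffices key : ∀ S Q, IsChainOn S Q → (∀ p ∈ S, β p < β (Q p)) →
      (∀ p ∈ S, ∀ p' ∈ S, p < p' → β (Q p) < β p') →
      ‖∑ p ∈ S, (seq h x (s (β p)) - seq h x (s (β (Q p)))) • h p‖ ≤ 3 * ‖x‖ ∧
      (IsRightDominant h →
        ‖∑ p ∈ S, (seq h x (s (β p)) - seq h x (s (β (Q p)))) • h p‖ ≤ 2 * ‖x‖) by
    have main : ∀ S Q, IsChainOn S Q → ∀ C, (∀ S' ⊆ S, (∀ p ∈ S', β p < β (Q p)) →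
        (∀ p ∈ S', ∀ p' ∈ S', p < p' → β (Q p) < β p') →
        ‖∑ p ∈ S', (seq h x (s (β p)) - seq h x (s (β (Q p)))) • h p‖ ≤ C) →
        ‖chainSum h (fun i => seq h x (s (β i))) S Q‖ ≤ C + C := by
      intro S Q hc C hC
      obtain ⟨S₀, hS₀, S₁, hS₁, hsum, h₀, h₁⟩ :=
        exists_split (E := E) (S.filter fun p => β p < β (Q p))
      have hcross : ∀ p ∈ S.filter (fun p => β p < β (Q p)), p ∈ S ∧ β p < β (Q p) :=
        fun p hp => Finset.mem_filter.1 hp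
      have hsep : ∀ S' ⊆ S.filter (fun p => β p < β (Q p)),
          (∀ p ∈ S', ∀ p' ∈ S', p < p' → ∃ r ∈ S.filter (fun p => β p < β (Q p)), p < r ∧ r < p') →
          ∀ p ∈ S', ∀ p' ∈ S', p < p' → β (Q p) < β p' := by
        intro S' hS' hS'' p hp p' hp' hpp'
        obtain ⟨r, hr, hpr, hrp'⟩ := hS'' p hp p' hp' hpp'
        have h1 := hβm (hc.next p (hcross p (hS' hp)).1 r (hcross r hr).1 hpr).le
        have h2 := hβm (hc.next r (hcross r hr).1 p' (hcross p' (hS' hp')).1 hrp').le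
        exact h1.trans_lt ((hcross r hr).2.trans_le h2)
      have hS : chainSum h (fun i => seq h x (s (β i))) S Q =
          ∑ p ∈ S.filter (fun p => β p < β (Q p)),
            (seq h x (s (β p)) - seq h x (s (β (Q p)))) • h p := by
        rw [chainSum, Finset.sum_filter]
        refine Finset.sum_congr rfl fun p hp => ?_
        split_ifs with hp'
        · rfl
        · rw [(hβm (hc.lt p hp).le).antisymm (not_lt.1 hp'), sub_self, zero_smul]
      rw [hS, hsum]
      exact (norm_add_le _ _).trans (add_le_add
        (hC S₀ (hS₀.trans (Finset.filter_subset _ _)) (fun p hp => (hcross p (hS₀ hp)).2)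
          (hsep S₀ hS₀ h₀))
        (hC S₁ (hS₁.trans (Finset.filter_subset _ _)) (fun p hp => (hcross p (hS₁ hp)).2)
          (hsep S₁ hS₁ h₁)))
    refine ⟨fun S Q hc => ?_, fun hrd S Q hc => ?_⟩
    · refine (main S Q hc (3 * ‖x‖) fun S' hS' h1 h2 => ?_).trans (by linarith)
      exact (key S' Q (hc.mono hS') h1 h2).1
    · refine (main S Q hc (2 * ‖x‖) fun S' hS' h1 h2 => ?_).trans (by linarith)
      exact (key S' Q (hc.mono hS') h1 h2).2 hrd
  intro S Q hc hcross hsep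
  have hsp : ∀ p ∈ S, ∀ p' ∈ S, p < p' → s (β p) < p' := fun p hp p' hp' hpp' =>
    hlt _ _ (by
      have := hcross p hp
      have := hsep p hp p' hp' hpp'
      omega)
  constructor
  · have hfirst : ‖∑ p ∈ S, (seq h x p - seq h x (s (β (Q p)))) • h p‖ ≤ ‖x‖ + ‖x‖ := by
      obtain ⟨S₀, hS₀, S₁, hS₁, hsum, h₀, h₁⟩ := exists_split (E := E) S
      have hpart : ∀ S' ⊆ S, (∀ p ∈ S', ∀ p' ∈ S', p < p' → ∃ r ∈ S, p < r ∧ r < p') →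
          ‖∑ p ∈ S', (seq h x p - seq h x (s (β (Q p)))) • h p‖ ≤ ‖x‖ := by
        intro S' hS' hS''
        refine norm_sum_pairs_le x (P := id) (R := fun p => s (β (Q p)))
          (fun p hp => (hle p).trans_lt (hsm (hcross p (hS' hp)))) fun p hp p' hp' hpp' => ?_
        obtain ⟨r, hr, hpr, hrp'⟩ := hS'' p hp p' hp' hpp'
        refine hlt _ _ ?_
        have h1 := hsep p (hS' hp) r hr hpr
        have h2 := hsep r hr p' (hS' hp') hrp'
        have h3 := hcross r hr
        simp only [id]
        omega
      rw [hsum]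
      exact (norm_add_le _ _).trans (add_le_add (hpart S₀ hS₀ h₀) (hpart S₁ hS₁ h₁))
    have hsecond : ‖∑ p ∈ S, (seq h x p - seq h x (s (β p))) • h p‖ ≤ ‖x‖ := by
      have : ∑ p ∈ S, (seq h x p - seq h x (s (β p))) • h p =
          ∑ p ∈ S.filter (fun p => p < s (β p)), (seq h x p - seq h x (s (β p))) • h p := by
        rw [Finset.sum_filter]
        refine Finset.sum_congr rfl fun p _ => ?_
        split_ifs with hp
        · rfl
        · rw [← (hle p).antisymm (not_lt.1 hp), sub_self, zero_smul]
      rw [this]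
      exact norm_sum_pairs_le x (P := id) (R := fun p => s (β p))
        (fun p hp => (Finset.mem_filter.1 hp).2) fun p hp p' hp' hpp' =>
          hsp p (Finset.mem_filter.1 hp).1 p' (Finset.mem_filter.1 hp').1 hpp'
    have : ∑ p ∈ S, (seq h x (s (β p)) - seq h x (s (β (Q p)))) • h p =
        ∑ p ∈ S, (seq h x p - seq h x (s (β (Q p)))) • h p -
        ∑ p ∈ S, (seq h x p - seq h x (s (β p))) • h p := by
      rw [← Finset.sum_sub_distrib]
      refine Finset.sum_congr rfl fun p _ => ?_
      rw [← sub_smul]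
      congr 1
      ring
    rw [this]
    refine (norm_sub_le _ _).trans ?_
    linarith
  · intro hrd
    refine (hrd.norm_sum_le (σ := fun p => s (β p)) (fun p _ => hle p) hsp
      fun p => seq h x (s (β p)) - seq h x (s (β (Q p)))).trans ?_
    refine mul_le_mul_of_nonneg_left ?_ zero_le_two
    exact norm_sum_pairs_le x (P := fun p => s (β p)) (R := fun p => s (β (Q p)))
      (fun p hp => hsm (hcross p hp)) fun p hp p' hp' hpp' => hsm (hsep p hp p' hp' hpp')

/-- An estimate for a linear map at all selections of points extends to weighted averages of the
points. -/
theorem norm_apply_average_le (T : (ℕ → 𝕜) →ₗ[𝕜] E) {N : ℕ}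
    (hT : ∀ v v' : ℕ → 𝕜, (∀ j < N, v j = v' j) → T v = T v') {x : ℕ → 𝕜} {F : ℕ → Finset ℕ}
    {w : ℕ → ℝ} (hw0 : ∀ s, 0 ≤ w s) (hw1 : ∀ j, ∑ s ∈ F j, w s = 1) {M : ℝ}
    (hM : ∀ σ : ℕ → ℕ, (∀ j, σ j ∈ F j) → ‖T fun j => x (σ j)‖ ≤ M) :
    ‖T fun j => ∑ s ∈ F j, (w s : 𝕜) * x s‖ ≤ M := by
  have hF : ∀ j, (F j).Nonempty := fun j => by
    rw [Finset.nonempty_iff_ne_empty]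
    intro hj
    simpa [hj] using hw1 j
  choose τ hτ using hF
  suffices H : ∀ n, ∀ v : ℕ → 𝕜, (∀ j < n, v j = ∑ s ∈ F j, (w s : 𝕜) * x s) →
      (∀ j, n ≤ j → ∃ s ∈ F j, v j = x s) → ‖T v‖ ≤ M by
    rw [hT _ (fun j => if j < N then ∑ s ∈ F j, (w s : 𝕜) * x s else x (τ j))
      fun j hj => by simp [hj]]
    refine H N _ (fun j hj => by simp [hj]) fun j hj => ⟨τ j, hτ j, by simp [not_lt.2 hj]⟩
  intro n
  induction n with
  | zero =>
    intro v _ hv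
    choose σ hσ hvσ using fun j => hv j (Nat.zero_le j)
    rw [funext hvσ]
    exact hM σ hσ
  | succ n ih =>
    intro v hv hv'
    have hw1' : ∑ s ∈ F n, (w s : 𝕜) = 1 := by
      exact_mod_cast congrArg (fun r : ℝ => (r : 𝕜)) (hw1 n)
    have hdec : v = ∑ s ∈ F n, (w s : 𝕜) • Function.update v n (x s) := by
      ext j
      rw [Finset.sum_apply]
      by_cases hj : j = n
      · subst hj
        simp [hv j (Nat.lt_succ_self j)]
      · simp [Function.update_of_ne hj, ← Finset.sum_mul, hw1']
    rw [hdec, map_sum]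
    calc ‖∑ s ∈ F n, T ((w s : 𝕜) • Function.update v n (x s))‖ ≤ ∑ s ∈ F n, w s * M := by
          refine norm_sum_le_of_le _ fun s hs => ?_
          rw [map_smul, norm_smul, RCLike.norm_ofReal, abs_of_nonneg (hw0 s)]
          refine mul_le_mul_of_nonneg_left (ih _ (fun j hj => ?_) fun j hj => ?_) (hw0 s)
          · rw [Function.update_of_ne hj.ne]
            exact hv j (hj.trans (Nat.lt_succ_self n))
          · rcases hj.eq_or_lt with rfl | hlt
            · exact ⟨s, hs, Function.update_self _ _ _⟩
            · rw [Function.update_of_ne hlt.ne']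
              exact hv' j hlt
      _ = M := by rw [← Finset.sum_mul, hw1, one_mul]

theorem chainBound_average {t : ℕ → ℕ} {w : ℕ → ℝ} (ht : StrictMono t) (hw0 : ∀ s, 0 ≤ w s)
    (hw1 : ∀ j, ∑ s ∈ Finset.Ico (t j) (t (j + 1)), w s = 1) (x : JamesSpace h) :
    ChainBound h (fun i => ∑ s ∈ Finset.Ico (t (shiftIndex t i)) (t (shiftIndex t i + 1)),
      (w s : 𝕜) * seq h x s) (6 * ‖x‖) ∧
    (IsRightDominant h →
      ChainBound h (fun i => ∑ s ∈ Finset.Ico (t (shiftIndex t i)) (t (shiftIndex t i + 1)),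
        (w s : 𝕜) * seq h x s) (4 * ‖x‖)) := by
  have main : ∀ C, (∀ σ : ℕ → ℕ, (∀ j, t j ≤ σ j ∧ σ j < t (j + 1)) →
      ChainBound h (fun i => seq h x (σ (shiftIndex t i))) C) →
      ChainBound h (fun i => ∑ s ∈ Finset.Ico (t (shiftIndex t i)) (t (shiftIndex t i + 1)),
        (w s : 𝕜) * seq h x s) C := by
    intro C hC S Q hc
    let T : (ℕ → 𝕜) →ₗ[𝕜] E :=
      { toFun := fun v => chainSum h (fun i => v (shiftIndex t i)) S Q
        map_add' := fun a b => chainSum_add _ _ _ S Q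
        map_smul' := fun c a => chainSum_smul _ c _ S Q }
    refine norm_apply_average_le T (N := (S ∪ S.image Q).sup (shiftIndex t) + 1)
      (fun v v' hv => ?_) (F := fun j => Finset.Ico (t j) (t (j + 1))) hw0 hw1 fun σ hσ =>
      hC σ (fun j => Finset.mem_Ico.1 (hσ j)) hc
    have hN : ∀ p ∈ S ∪ S.image Q, v (shiftIndex t p) = v' (shiftIndex t p) := fun p hp =>
      hv _ (Nat.lt_succ_of_le (Finset.le_sup (f := shiftIndex t) hp))
    refine Finset.sum_congr rfl fun p hp => ?_
    dsimp only
    rw [hN p (Finset.mem_union_left _ hp),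
      hN (Q p) (Finset.mem_union_right _ (Finset.mem_image_of_mem Q hp))]
  exact ⟨main _ fun σ hσ => (chainBound_step ht hσ x).1,
    fun hrd => main _ fun σ hσ => (chainBound_step ht hσ x).2 hrd⟩

end JamesSpace

/-- The convex combination of the values at the points of `[a, b)`, as a combination of averages
over singletons. -/
def BlockAverage.ofWeights {a b : ℕ} (hab : a ≤ b) (w : ℕ → ℝ) (hw0 : ∀ s, 0 ≤ w s)
    (hw1 : ∑ s ∈ Finset.Ico a b, w s = 1) : BlockAverage a b where
  k := b - a
  n r := a + r
  strictMono r r' hr := Nat.add_lt_add_left hr a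
  first := rfl
  last := Nat.add_sub_cancel' hab
  weight r := w (a + r)
  weight_nonneg r := hw0 _
  weight_sum := by
    rwa [Finset.sum_Ico_eq_sum_range, Finset.sum_range] at hw1

theorem BlockAverage.eval_ofWeights {𝕜 : Type*} [RCLike 𝕜] {a b : ℕ} (hab : a ≤ b) (w : ℕ → ℝ)
    (hw0 : ∀ s, 0 ≤ w s) (hw1 : ∑ s ∈ Finset.Ico a b, w s = 1) (x : ℕ → 𝕜) :
    (BlockAverage.ofWeights hab w hw0 hw1).eval x = ∑ s ∈ Finset.Ico a b, (w s : 𝕜) * x s := by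
  rw [Finset.sum_Ico_eq_sum_range, Finset.sum_range]
  simp only [BlockAverage.eval, BlockAverage.ofWeights]
  refine Finset.sum_congr rfl fun r _ => ?_
  simp [← add_assoc]

/-- The block scheme whose averaging functionals are given by pointwise weights. -/
def BlockScheme.ofWeights {t : ℕ → ℕ} (ht : StrictMono t) (h0 : t 0 = 0) (w : ℕ → ℝ)
    (hw0 : ∀ s, 0 ≤ w s) (hw1 : ∀ j, ∑ s ∈ Finset.Ico (t j) (t (j + 1)), w s = 1) :
    BlockScheme where
  t := t
  strictMono := ht
  zero := h0
  avg j := BlockAverage.ofWeights (ht (Nat.lt_succ_self j)).le w hw0 (hw1 j)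

theorem BlockScheme.shiftVec_eq {𝕜 E : Type*} [RCLike 𝕜] [NormedAddCommGroup E] [NormedSpace 𝕜 E]
    (S : BlockScheme) (h : SchauderBasis 𝕜 E) (j : ℕ) :
    S.shiftVec h j = ∑ s ∈ Finset.Ico (JamesSpace.shiftEnd S.t j) (JamesSpace.shiftEnd S.t (j + 1)),
      JamesSpace.unitVec h s := by
  match j with
  | 0 => simp [shiftVec, JamesSpace.shiftEnd]
  | 1 => rfl
  | j + 2 => rfl

/-- An operator is weakly compact if its second adjoint takes values in the space. -/
theorem isWeaklyCompactOperator_of_bidual {𝕜 X Y : Type*} [RCLike 𝕜] [NormedAddCommGroup X]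
    [NormedSpace 𝕜 X] [NormedAddCommGroup Y] [NormedSpace 𝕜 Y] (V : X →L[𝕜] Y)
    (hV : ∀ φ : StrongDual 𝕜 (StrongDual 𝕜 X), ∃ y : Y, ∀ f : StrongDual 𝕜 Y, φ (f.comp V) = f y) :
    IsWeaklyCompactOperator V := by
  refine NormedSpace.isCompact_closure_of_isBounded 𝕜 Y _ ?_ ?_
  · rw [Set.preimage_image_eq _ (toWeakSpace 𝕜 Y).injective]
    exact V.lipschitz.isBounded_image Metric.isBounded_closedBall
  · let A : StrongDual 𝕜 Y →L[𝕜] StrongDual 𝕜 X := (ContinuousLinearMap.compL 𝕜 X Y 𝕜).flip V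
    let B : WeakDual 𝕜 (StrongDual 𝕜 X) → WeakDual 𝕜 (StrongDual 𝕜 Y) := fun φ =>
      StrongDual.toWeakDual ((WeakDual.toStrongDual φ).comp A)
    have hB : Continuous B :=
      WeakDual.continuous_of_continuous_eval fun f => WeakDual.eval_continuous (A f)
    have hK := (WeakDual.isCompact_closedBall (𝕜 := 𝕜)
      (0 : StrongDual 𝕜 (StrongDual 𝕜 X)) 1).image hB
    refine (closure_minimal ?_ hK.isClosed).trans ?_
    · rintro _ ⟨_, ⟨_, ⟨x, hx, rfl⟩, rfl⟩, rfl⟩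
      refine ⟨StrongDual.toWeakDual (NormedSpace.inclusionInDoubleDual 𝕜 X x), ?_, ?_⟩
      · have := (NormedSpace.double_dual_bound 𝕜 X x).trans (mem_closedBall_zero_iff.1 hx)
        simpa using this
      · rfl
    · rintro _ ⟨φ, -, rfl⟩
      obtain ⟨y, hy⟩ := hV (WeakDual.toStrongDual φ)
      refine ⟨toWeakSpace 𝕜 Y y, ?_⟩
      exact DFunLike.ext _ _ fun f => (hy f).symm

theorem IsWeaklyCompactSet.exists_norm_le {𝕜 X : Type*} [RCLike 𝕜] [NormedAddCommGroup X]
    [NormedSpace 𝕜 X] {D : Set X} (hD : IsWeaklyCompactSet 𝕜 D) :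
    ∃ C, ∀ x ∈ D, ‖x‖ ≤ C := by
  obtain ⟨C, hC⟩ := banach_steinhaus
    (g := fun x : D => NormedSpace.inclusionInDoubleDual 𝕜 X x) fun f => by
      have hf : Continuous fun z : WeakSpace 𝕜 X => f ((toWeakSpace 𝕜 X).symm z) :=
        WeakBilin.eval_continuous _ f
      obtain ⟨C, hC⟩ := (hD.image hf).isBounded.exists_norm_le
      exact ⟨C, fun x => hC _ ⟨_, ⟨x, x.2, rfl⟩, rfl⟩⟩
  exact ⟨C, fun x hx =>
    ((NormedSpace.inclusionInDoubleDualLi (E := X) 𝕜).norm_map x).symm.trans_le (hC ⟨x, hx⟩)⟩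

namespace JamesSpace

variable {𝕜 E : Type*} [RCLike 𝕜] [NormedAddCommGroup E] [NormedSpace 𝕜 E]
  {h : SchauderBasis 𝕜 E}

/-- The weighted average over `[t j, t (j + 1))` as a functional. -/
noncomputable def averageCLM (h : SchauderBasis 𝕜 E) (t : ℕ → ℕ) (w : ℕ → ℝ) (j : ℕ) :
    StrongDual 𝕜 (JamesSpace h) :=
  ∑ s ∈ Finset.Ico (t j) (t (j + 1)), (w s : 𝕜) • coordCLM h s

theorem averageCLM_apply (t : ℕ → ℕ) (w : ℕ → ℝ) (j : ℕ) (x : JamesSpace h) :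
    averageCLM h t w j x = ∑ s ∈ Finset.Ico (t j) (t (j + 1)), (w s : 𝕜) * seq h x s := by
  simp [averageCLM]

section Shift

variable {t : ℕ → ℕ} {w : ℕ → ℝ}

theorem tendsto_averageCLM (ht : StrictMono t) (hw0 : ∀ s, 0 ≤ w s)
    (hw1 : ∀ j, ∑ s ∈ Finset.Ico (t j) (t (j + 1)), w s = 1) (x : JamesSpace h) :
    Tendsto (fun i => averageCLM h t w (shiftIndex t i) x) atTop (𝓝 0) := by
  refine Metric.tendsto_atTop.2 fun ε hε => ?_
  obtain ⟨K, hK⟩ := Metric.tendsto_atTop.1 (tendsto_seq x) (ε / 2) (half_pos hε)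
  refine ⟨K, fun i hi => ?_⟩
  rw [dist_zero_right, averageCLM_apply]
  refine lt_of_le_of_lt ?_ (half_lt_self hε)
  calc _ ≤ ∑ s ∈ Finset.Ico (t (shiftIndex t i)) (t (shiftIndex t i + 1)), w s * (ε / 2) := by
        refine norm_sum_le_of_le _ fun s hs => ?_
        rw [norm_mul, RCLike.norm_ofReal, abs_of_nonneg (hw0 s)]
        have := hK s (hi.trans ((le_apply_shiftIndex ht i).trans (Finset.mem_Ico.1 hs).1))
        rw [dist_zero_right] at this
        exact mul_le_mul_of_nonneg_left this.le (hw0 s)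
    _ = ε / 2 := by rw [← Finset.sum_mul, hw1, one_mul]

/-- The shifted sum of weighted averages is a bounded operator. -/
theorem exists_shiftCLM (ht : StrictMono t) (hw0 : ∀ s, 0 ≤ w s)
    (hw1 : ∀ j, ∑ s ∈ Finset.Ico (t j) (t (j + 1)), w s = 1) :
    ∃ W : JamesSpace h →L[𝕜] JamesSpace h,
      (∀ x i, seq h (W x) i = averageCLM h t w (shiftIndex t i) x) ∧ ‖W‖ ≤ 6 ∧
      (IsRightDominant h → ‖W‖ ≤ 4) := by
  have hb : ∀ x : JamesSpace h, ChainBound h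
      (fun i => averageCLM h t w (shiftIndex t i) x) (6 * ‖x‖) ∧
      (IsRightDominant h →
        ChainBound h (fun i => averageCLM h t w (shiftIndex t i) x) (4 * ‖x‖)) := fun x => by
    simp only [averageCLM_apply]
    exact chainBound_average ht hw0 hw1 x
  choose W hW hW6 using fun x => exists_seq_eq (tendsto_averageCLM ht hw0 hw1 x) (hb x).1
  let L : JamesSpace h →ₗ[𝕜] JamesSpace h :=
    { toFun := W
      map_add' := fun x y => seq_injective (by ext i; simp [hW])
      map_smul' := fun c x => seq_injective (by ext i; simp [hW]) }
  refine ⟨L.mkContinuous 6 hW6, fun x i => congrFun (hW x) i,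
    LinearMap.mkContinuous_norm_le _ (by norm_num) _, fun hrd => ?_⟩
  refine ContinuousLinearMap.opNorm_le_bound _ (by norm_num) fun x => ?_
  refine norm_le_of_chainBound ?_
  change ChainBound h (seq h (W x)) _
  rw [hW]
  exact (hb x).2 hrd

theorem sum_average_smul_eq_trunc (ht : StrictMono t) {x y : JamesSpace h}
    (hy : ∀ i, seq h y i = averageCLM h t w (shiftIndex t i) x) (N : ℕ) :
    ∑ j ∈ Finset.range N, averageCLM h t w j x •
      ∑ s ∈ Finset.Ico (shiftEnd t j) (shiftEnd t (j + 1)), unitVec h s =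
      trunc h (shiftEnd t N) y := by
  induction N with
  | zero => simp [shiftEnd, trunc_apply]
  | succ N ih =>
    rw [Finset.sum_range_succ, ih, trunc_apply, trunc_apply,
      ← Finset.sum_range_add_sum_Ico _ (monotone_shiftEnd ht (Nat.le_succ N)), Finset.smul_sum]
    congr 1
    refine Finset.sum_congr rfl fun i hi => ?_
    rw [Finset.mem_Ico] at hi
    rw [hy, shiftIndex_eq ht hi.1 hi.2]

theorem tendsto_sum_average_smul (hE : IsReflexiveSpace 𝕜 E) (hnorm : ∀ j, ‖h j‖ = 1)
    (ht : StrictMono t) {x y : JamesSpace h}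
    (hy : ∀ i, seq h y i = averageCLM h t w (shiftIndex t i) x) :
    Tendsto (fun N => ∑ j ∈ Finset.range N, averageCLM h t w j x •
      ∑ s ∈ Finset.Ico (shiftEnd t j) (shiftEnd t (j + 1)), unitVec h s) atTop (𝓝 y) := by
  simp only [sum_average_smul_eq_trunc ht hy]
  refine (tendsto_trunc hE hnorm y).comp ?_
  refine (tendsto_add_atTop_iff_nat 1).1 (tendsto_atTop_mono (le_shiftEnd_succ ht) tendsto_id)

/-- Subtracting the shifted sum of averages from the identity yields a weakly compact operator. -/
theorem isWeaklyCompactOperator_id_sub (hE : IsReflexiveSpace 𝕜 E) (hnorm : ∀ j, ‖h j‖ = 1)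
    (hw1 : ∀ j, ∑ s ∈ Finset.Ico (t j) (t (j + 1)), w s = 1)
    {W : JamesSpace h →L[𝕜] JamesSpace h}
    (hW : ∀ x i, seq h (W x) i = averageCLM h t w (shiftIndex t i) x) :
    IsWeaklyCompactOperator (ContinuousLinearMap.id 𝕜 (JamesSpace h) - W) := by
  set V := ContinuousLinearMap.id 𝕜 (JamesSpace h) - W with hV
  refine isWeaklyCompactOperator_of_bidual V fun φ => ?_
  obtain ⟨x, c, hx⟩ := bidual_exists_coord_eq hE hnorm φ
  refine ⟨V x, fun f => ?_⟩
  let A : StrongDual 𝕜 (JamesSpace h) →L[𝕜] StrongDual 𝕜 (JamesSpace h) :=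
    (ContinuousLinearMap.compL 𝕜 _ _ 𝕜).flip V
  have key : φ.comp A = NormedSpace.inclusionInDoubleDual 𝕜 _ (V x) := by
    refine bidual_ext hE hnorm fun i => ?_
    have hA : A (coordCLM h i) = coordCLM h i - averageCLM h t w (shiftIndex t i) := by
      ext y
      change seq h (V y) i = _
      simp [hV, hW]
    have hw1' : ∑ s ∈ Finset.Ico (t (shiftIndex t i)) (t (shiftIndex t i + 1)), (w s : 𝕜) = 1 := by
      exact_mod_cast congrArg (fun r : ℝ => (r : 𝕜)) (hw1 (shiftIndex t i))
    have hφ : φ (averageCLM h t w (shiftIndex t i)) = averageCLM h t w (shiftIndex t i) x + c := by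
      rw [averageCLM_apply]
      simp only [averageCLM, map_sum, map_smul, smul_eq_mul, hx, mul_add, Finset.sum_add_distrib,
        ← Finset.sum_mul, hw1', one_mul]
    rw [ContinuousLinearMap.comp_apply, hA, map_sub, hx, hφ, NormedSpace.dual_def, coordCLM_apply]
    simp [hV, hW]
  exact congrArg (fun ψ => ψ f) key

end Shift

/-- On a weakly compact set, suitable weighted averages of the coordinates are as small as
desired. -/
theorem exists_weights (hnorm : ∀ j, ‖h j‖ = 1) {D : Set (JamesSpace h)}
    (hD : IsWeaklyCompactSet 𝕜 D) {δ : ℕ → ℝ} (hδ : ∀ j, 0 < δ j) :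
    ∃ (t : ℕ → ℕ) (w : ℕ → ℝ), StrictMono t ∧ t 0 = 0 ∧ (∀ s, 0 ≤ w s) ∧
      (∀ j, ∑ s ∈ Finset.Ico (t j) (t (j + 1)), w s = 1) ∧
      ∀ j, ∀ x ∈ D, ‖averageCLM h t w j x‖ ≤ δ j := by
  obtain ⟨C, hC⟩ := hD.exists_norm_le
  have : T2Space (WeakSpace 𝕜 (JamesSpace h)) :=
    (NormedSpace.isEmbedding_inclusionInDoubleDualWeak 𝕜 (JamesSpace h)).t2Space
  let K : Set (WeakSpace 𝕜 (JamesSpace h)) := toWeakSpace 𝕜 (JamesSpace h) '' D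
  have : CompactSpace K := isCompact_iff_compactSpace.1 hD
  have hstep : ∀ j N, ∃ b > N, ∃ w : ℕ → ℝ, (∀ n, 0 ≤ w n) ∧ ∑ n ∈ Finset.Ico N b, w n = 1 ∧
      ∀ x ∈ D, ∑ n ∈ Finset.Ico N b, w n * ‖seq h x n‖ ≤ δ j := by
    intro j N
    have hmem : ∀ P : K,
        (toWeakSpace 𝕜 (JamesSpace h)).symm P.1 ∈ D := by
      rintro ⟨_, x, hx, rfl⟩
      simpa using hx
    have hcont : ∀ n, Continuous fun P : K =>
        ‖coordCLM h n ((toWeakSpace 𝕜 (JamesSpace h)).symm P.1)‖ := fun n => by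
      have hc : Continuous fun z : WeakSpace 𝕜 (JamesSpace h) =>
          coordCLM h n ((toWeakSpace 𝕜 (JamesSpace h)).symm z) :=
        WeakBilin.eval_continuous _ (coordCLM h n)
      have hval : Continuous fun P : K => (P : WeakSpace 𝕜 (JamesSpace h)) :=
        continuous_subtype_val
      exact (hc.comp hval).norm
    obtain ⟨b, hb, w, hw0, hw1, hw⟩ := exists_convexCombination_le (X := K)
      (g := fun n (P : K) =>
        ‖coordCLM h n ((toWeakSpace 𝕜 (JamesSpace h)).symm P.1)‖)
      hcont (fun _ _ => norm_nonneg _)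
      (fun n P => (norm_seq_le hnorm _ n).trans (hC _ (hmem P)))
      (fun P => tendsto_zero_iff_norm_tendsto_zero.1 (tendsto_seq _)) N (hδ j)
    exact ⟨b, hb, w, hw0, hw1, fun x hx => hw ⟨_, x, hx, rfl⟩⟩
  choose b hb w hw0 hw1 hw using hstep
  obtain ⟨t, ht0, hts⟩ : ∃ t : ℕ → ℕ, t 0 = 0 ∧ ∀ j, t (j + 1) = b j (t j) :=
    ⟨fun j => Nat.rec 0 (fun j N => b j N) j, rfl, fun _ => rfl⟩
  have ht : StrictMono t := strictMono_nat_of_lt_succ fun j => by rw [hts]; exact hb j (t j)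
  let κ : ℕ → ℕ := fun s => Nat.findGreatest (fun j => t j ≤ s) s
  have hκ : ∀ j, ∀ s ∈ Finset.Ico (t j) (t (j + 1)), κ s = j := by
    intro j s hs
    rw [Finset.mem_Ico] at hs
    have h1 : j ≤ s := ht.le_apply.trans hs.1
    have h2 : j ≤ κ s := Nat.le_findGreatest h1 hs.1
    have h3 : t (κ s) ≤ s := Nat.findGreatest_spec (P := fun j => t j ≤ s) h1 hs.1
    have h4 := ht.lt_iff_lt.1 (h3.trans_lt hs.2)
    omega
  refine ⟨t, fun s => w (κ s) (t (κ s)) s, ht, ht0, fun s => hw0 _ _ _, fun j => ?_,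
    fun j x hx => ?_⟩
  · refine Eq.trans ?_ (hw1 j (t j))
    rw [← hts]
    exact Finset.sum_congr rfl fun s hs => by simp only [hκ j s hs]
  · rw [averageCLM_apply]
    refine le_trans ?_ (hw j (t j) x hx)
    rw [← hts]
    refine norm_sum_le_of_le _ fun s hs => ?_
    rw [norm_mul, RCLike.norm_ofReal, abs_of_nonneg (hw0 _ _ _), hκ j s hs]

theorem hasBlockApproximation (hE : IsReflexiveSpace 𝕜 E) (hnorm : ∀ j, ‖h j‖ = 1) :
    HasBlockApproximation h 7 ∧ (IsRightDominant h → HasBlockApproximation h 5) := by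
  suffices key : ∀ C, (∀ W : JamesSpace h →L[𝕜] JamesSpace h, ‖W‖ ≤ 6 →
      (IsRightDominant h → ‖W‖ ≤ 4) → ‖W‖ ≤ C) → HasBlockApproximation h (1 + C) by
    refine ⟨?_, fun hrd => ?_⟩
    · convert key 6 fun W hW _ => hW using 1; norm_num
    · convert key 4 fun W _ hW => hW hrd using 1; norm_num
  intro C hC D hD ε hε
  obtain ⟨t, w, ht, ht0, hw0, hw1, hDw⟩ := exists_weights hnorm hD
    (δ := fun j => ε / 8 * (1 / 2) ^ j) fun j => by positivity
  obtain ⟨W, hW, hW6, hW4⟩ := exists_shiftCLM (h := h) ht hw0 hw1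
  have hlim := fun x => tendsto_sum_average_smul hE hnorm ht (hW x)
  refine ⟨BlockScheme.ofWeights ht ht0 w hw0 hw1, W, fun x => ?_,
    isWeaklyCompactOperator_id_sub hE hnorm hw1 hW, ⟨ε / 2, half_lt_self hε, fun x hx => ?_⟩, ?_⟩
  · refine (hlim x).congr fun N => Finset.sum_congr rfl fun j _ => ?_
    rw [BlockScheme.shiftVec_eq, averageCLM_apply]
    exact congrArg (· • _)
      (BlockAverage.eval_ofWeights (ht (Nat.lt_succ_self j)).le w hw0 (hw1 j) (seq h x)).symm
  · rw [sub_apply, ContinuousLinearMap.id_apply, sub_sub_cancel]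
    refine le_of_tendsto (hlim x).norm (Eventually.of_forall fun N => ?_)
    calc _ ≤ ∑ j ∈ Finset.range N, ε / 8 * (1 / 2) ^ j * 2 := by
          refine norm_sum_le_of_le _ fun j _ => ?_
          rw [norm_smul]
          exact mul_le_mul (hDw j x hx) (norm_sum_Ico_unitVec_le hnorm _ _) (norm_nonneg _)
            (by positivity)
      _ = ε / 4 * ∑ j ∈ Finset.range N, (1 / 2 : ℝ) ^ j := by
          rw [Finset.mul_sum]
          exact Finset.sum_congr rfl fun j _ => by ring
      _ ≤ ε / 4 * 2 := mul_le_mul_of_nonneg_left (sum_geometric_two_le N) (by positivity)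
      _ = ε / 2 := by ring
  · exact (norm_sub_le _ _).trans (add_le_add ContinuousLinearMap.norm_id_le (hC W hW6 hW4))

end JamesSpace

theorem theorem4p4 {𝕜 E : Type*} [RCLike 𝕜] [NormedAddCommGroup E] [NormedSpace 𝕜 E]
    [CompleteSpace E] (hE : IsReflexiveSpace 𝕜 E) (h : SchauderBasis 𝕜 E)
    (hnorm : ∀ j, ‖h j‖ = 1) :
    CompleteSpace (JamesSpace h) ∧
    IsQuasiReflexiveOfOrderOne 𝕜 (JamesSpace h) ∧
    HasWAP 𝕜 (JamesSpace h) ∧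
    (∃ C : ℝ, HasBlockApproximation h C) ∧
    (IsOneUnconditional h → IsRightDominant h → HasBlockApproximation h 5) := by
  have happ := JamesSpace.hasBlockApproximation hE hnorm
  refine ⟨JamesSpace.completeSpace hnorm, JamesSpace.isQuasiReflexiveOfOrderOne hE hnorm,
    ⟨7, fun D hD ε hε => ?_⟩, ⟨7, happ.1⟩, fun _ hrd => happ.2 hrd⟩
  obtain ⟨S, W, -, hwc, hapx, hW⟩ := happ.1 D hD ε hε
  exact ⟨_, hwc, hapx, hW⟩
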